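/- Let $\Gamma\rightrightarrows M$ and $\tilde\Gamma\rightrightarrows M$ be Lie groupoids with source and target maps $s,t$ (products $xy$ are defined when $s(x)=t(y)$), let $G$ be a connected Lie group with Lie algebra $\mathfrak g$, and assume that $G$ is reductive, i.e. that every ideal of $\mathfrak g$ has a complementary ideal; then $\mathfrak g=\mathfrak z(\mathfrak g)\oplus[\mathfrak g,\mathfrak g]$, and $\mathrm{pr}:\mathfrak g\to\mathfrak z(\mathfrak g)$ denotes the corresponding projection onto the center. Let $$1\to M\times G\xrightarrow{\,i\,}\tilde\Gamma\xrightarrow{\,\phi\,}\Gamma\to 1$$ be a $G$-extension, that is, a short exact sequence of Lie groupoids over the identity of $M$, where $M\times G$ is the trivial bundle of groups, $\phi$ is a surjective submersion and $i$ is an embedding onto the kernel of $\phi$. For $g\in G$ and $x\in\tilde\Gamma$ write $xg=x\cdot i(s(x),g)$ and $gx=i(t(x),g)\cdot x$. Assume that the extension is central: if $q:\tilde\Gamma\to\tilde\Gamma/Z(G)$ is the projection, the map $\tilde\Gamma/Z(G)\to\Gamma$ induced by $\phi$ has a smooth section $\sigma$ such that $xg=gx$ for all $x\in q^{-1}(\sigma(\Gamma))$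 and all $g\in G$. For a finite-dimensional real vector space $V$ let $C^k(\Gamma,V)=\bigoplus_{p+q=k}\Omega^p(N_q\Gamma,V)$, where $N_\bullet\Gamma$ is the nerve of $\Gamma$, with the total differential $d+\partial$, where $d$ is the de Rham differential and $\partial=(-1)^p\sum_{i=0}^{q+1}(-1)^i d_i^*:\Omega^p(N_q\Gamma,V)\to\Omega^p(N_{q+1}\Gamma,V)$, with $d_i$ the face maps of the nerve. Let $Z^k(\Gamma,V)$ and $B^k(\Gamma,V)$ be the spaces of cocycles and coboundaries of degree $k$, $H^k(\Gamma,V)=Z^k(\Gamma,V)/B^k(\Gamma,V)$ and $H^k(\Gamma)=H^k(\Gamma,\mathbb R)$; likewise for $\tilde\Gamma$. A connection 1-form is a smooth $\alpha\in\Omega^1(\tilde\Gamma,\mathfrak g)$ with $R_g^*\alpha=\mathrm{Ad}_{g^{-1}}\circ\alpha$ for all $g\in G$, where $R_g(x)=xg$, and $\alpha(\hat\xi_x)=\xi$ for all $\xi\in\mathfrak g$ and $x\in\tilde\Gamma$, where $\hat\xi_x=\frac{d}{dt}\big|_{t=0}\,x\,e^{t\xi}$. It is regarded as an element of $\Omega^1(N_1\tilde\Gamma,\mathfrak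 g)$. Then: 1. For each connection 1-form $\alpha$ there is a unique cocycle $\Omega_\alpha\in Z^3(\Gamma,\mathfrak z(\mathfrak g))$ such that $\mathrm{pr}(d\alpha+\partial\alpha)=\phi^*(\Omega_\alpha)$. 2. If $\alpha_1$ and $\alpha_2$ are connection 1-forms, then $\Omega_{\alpha_1}-\Omega_{\alpha_2}\in B^3(\Gamma,\mathfrak z(\mathfrak g))$. 3. Consequently the Dixmier–Douady class of the extension is well defined: if connection 1-forms exist, there is a unique element of $H^3(\Gamma)\otimes\mathfrak z(\mathfrak g)$ whose image under the canonical map $H^3(\Gamma)\otimes\mathfrak z(\mathfrak g)\to H^3(\Gamma,\mathfrak z(\mathfrak g))$, $[c]\otimes v\mapsto[c\,v]$, is the class $[\Omega_\alpha]$ for every connection 1-form $\alpha$. -/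

import Mathlib

open scoped Manifold ContDiff TensorProduct

noncomputable section

/-! ## Lie groupoids -/

/-- A Lie groupoid `Γ ⇉ M`, with `dim M = m` and `dim Γ = n`. The product `mul x y` is meaningful
only if `src x = tgt y`; its values at other pairs are never used. -/
structure LieGroupoid (m n : ℕ) (M Γ : Type*)
    [TopologicalSpace M] [ChartedSpace (EuclideanSpace ℝ (Fin m)) M]
    [TopologicalSpace Γ] [ChartedSpace (EuclideanSpace ℝ (Fin n)) Γ] where
  src : Γ → M
  tgt : Γ → M
  one : M → Γ
  inv : Γ → Γ
  mul : Γ → Γ → Γ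
  src_one : ∀ a, src (one a) = a
  tgt_one : ∀ a, tgt (one a) = a
  src_mul : ∀ x y, src x = tgt y → src (mul x y) = src y
  tgt_mul : ∀ x y, src x = tgt y → tgt (mul x y) = tgt x
  mul_assoc : ∀ x y z, src x = tgt y → src y = tgt z → mul (mul x y) z = mul x (mul y z)
  one_mul : ∀ x, mul (one (tgt x)) x = x
  mul_one : ∀ x, mul x (one (src x)) = x
  src_inv : ∀ x, src (inv x) = tgt x
  tgt_inv : ∀ x, tgt (inv x) = src x
  inv_mul : ∀ x, mul (inv x) x = one (src x)
  mul_inv : ∀ x, mul x (inv x) = one (tgt x)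
  isSubmersion_src : Manifold.IsSubmersion (𝓡 n) (𝓡 m) ∞ src
  isSubmersion_tgt : Manifold.IsSubmersion (𝓡 n) (𝓡 m) ∞ tgt
  contMDiff_one : ContMDiff (𝓡 m) (𝓡 n) ∞ one
  contMDiff_inv : ContMDiff (𝓡 n) (𝓡 n) ∞ inv
  /-- Multiplication is smooth on the embedded submanifold of composable pairs. -/
  contMDiffOn_mul : ContMDiffOn ((𝓡 n).prod (𝓡 n)) (𝓡 n) ∞
    (fun p : Γ × Γ ↦ mul p.1 p.2) {p | src p.1 = tgt p.2}

namespace LieGroupoid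

variable {m n n' r : ℕ} {M Γ Γ' G V W : Type*}
  [TopologicalSpace M] [ChartedSpace (EuclideanSpace ℝ (Fin m)) M]
  [TopologicalSpace Γ] [ChartedSpace (EuclideanSpace ℝ (Fin n)) Γ]
  [TopologicalSpace Γ'] [ChartedSpace (EuclideanSpace ℝ (Fin n')) Γ']
  [NormedAddCommGroup V] [NormedSpace ℝ V] [NormedAddCommGroup W] [NormedSpace ℝ W]

/-! ## The nerve -/

/-- The `q`-simplices of the nerve of a groupoid: commutative diagrams with vertices
`obj 0, …, obj q` and edges `hom i j` from `obj j` to `obj i`. Such a diagram is the same thing as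
the composable string `hom 0 1, hom 1 2, …, hom (q-1) q` (as `Γ` is a groupoid, the edges with
`i ≥ j` are units and inverses). -/
@[ext]
structure Simplex (𝒢 : LieGroupoid m n M Γ) (q : ℕ) where
  obj : Fin (q + 1) → M
  hom : Fin (q + 1) → Fin (q + 1) → Γ
  tgt_hom : ∀ i j, 𝒢.tgt (hom i j) = obj i
  src_hom : ∀ i j, 𝒢.src (hom i j) = obj j
  hom_mul_hom : ∀ i j k, 𝒢.mul (hom i j) (hom j k) = hom i k

/-- The `i`-th face map omits the `i`-th vertex. On `N₂` it maps the composable pair `(x, y)` to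
`y`, `xy`, `x` for `i = 0, 1, 2`. On `N₁` it maps `x` to `src x`, `tgt x` for `i = 0, 1`. -/
def Simplex.face {𝒢 : LieGroupoid m n M Γ} {q : ℕ} (i : Fin (q + 2)) (σ : 𝒢.Simplex (q + 1)) :
    𝒢.Simplex q where
  obj a := σ.obj (i.succAbove a)
  hom a b := σ.hom (i.succAbove a) (i.succAbove b)
  tgt_hom _ _ := σ.tgt_hom _ _
  src_hom _ _ := σ.src_hom _ _
  hom_mul_hom _ _ _ := σ.hom_mul_hom _ _ _

/-- Smooth maps `ℝᵏ → N_q`. As `N_q` is an embedded submanifold of a product of copies of `M`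
and `Γ`, smoothness is tested on the components. -/
def IsPlot (𝒢 : LieGroupoid m n M Γ) (q k : ℕ)
    (P : EuclideanSpace ℝ (Fin k) → 𝒢.Simplex q) : Prop :=
  (∀ i, ContMDiff (𝓡 k) (𝓡 m) ∞ fun u ↦ (P u).obj i) ∧
    ∀ i j, ContMDiff (𝓡 k) (𝓡 n) ∞ fun u ↦ (P u).hom i j

/-- The type of smooth maps `ℝᵏ → N_q`. -/
def Plot (𝒢 : LieGroupoid m n M Γ) (q k : ℕ) : Type _ :=
  {P : EuclideanSpace ℝ (Fin k) → 𝒢.Simplex q // 𝒢.IsPlot q k P}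

/-- Composition of a smooth map `ℝᵏ → N_q` with a smooth map `ℝˡ → ℝᵏ`. -/
def Plot.comp {𝒢 : LieGroupoid m n M Γ} {q k l : ℕ} (P : 𝒢.Plot q k)
    (f : EuclideanSpace ℝ (Fin l) → EuclideanSpace ℝ (Fin k)) (hf : ContDiff ℝ ∞ f) :
    𝒢.Plot q l :=
  ⟨P.1 ∘ f, fun i ↦ (P.2.1 i).comp hf.contMDiff, fun i j ↦ (P.2.2 i j).comp hf.contMDiff⟩

/-- A smooth map `N_q(𝒢') → N_{q'}(𝒢)`, tested on smooth maps from the spaces `ℝᵏ`. -/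
def IsSmoothMap (𝒢' : LieGroupoid m n' M Γ') (𝒢 : LieGroupoid m n M Γ) (q q' : ℕ)
    (F : 𝒢'.Simplex q → 𝒢.Simplex q') : Prop :=
  ∀ (k : ℕ) (P : 𝒢'.Plot q k), 𝒢.IsPlot q' k (F ∘ P.1)

theorem isSmoothMap_face (𝒢 : LieGroupoid m n M Γ) (q : ℕ) (i : Fin (q + 2)) :
    IsSmoothMap 𝒢 𝒢 (q + 1) q (Simplex.face i) :=
  fun _ P ↦ ⟨fun _ ↦ P.2.1 _, fun _ _ ↦ P.2.2 _ _⟩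

/-! ## Differential forms on the nerve -/

/-- The type of families which assign to every smooth map `ℝᵏ → N_q`, for every `k`, a (not yet
smooth) `V`-valued differential form of degree `p` on `ℝᵏ`. -/
abbrev FormFamily (𝒢 : LieGroupoid m n M Γ) (p q : ℕ) (V : Type*)
    [NormedAddCommGroup V] [NormedSpace ℝ V] : Type _ :=
  ∀ k : ℕ, 𝒢.Plot q k → EuclideanSpace ℝ (Fin k) → EuclideanSpace ℝ (Fin k) [⋀^Fin p]→L[ℝ] V

/-- The members of the family are smooth, and they are compatible: the member at `P ∘ f` is the
pullback along `f` of the member at `P`, for every smooth `f : ℝˡ → ℝᵏ`. -/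
structure FormFamily.IsForm {𝒢 : LieGroupoid m n M Γ} {p q : ℕ} (θ : 𝒢.FormFamily p q V) :
    Prop where
  contDiff : ∀ (k : ℕ) (P : 𝒢.Plot q k), ContDiff ℝ ∞ (θ k P)
  comp : ∀ (k l : ℕ) (P : 𝒢.Plot q k)
    (f : EuclideanSpace ℝ (Fin l) → EuclideanSpace ℝ (Fin k)) (hf : ContDiff ℝ ∞ f)
    (u : EuclideanSpace ℝ (Fin l)),
    θ l (P.comp f hf) u = (θ k P (f u)).compContinuousLinearMap (fderiv ℝ f u)

/-- The linear subspace of smooth compatible families. -/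
def formSubmodule (𝒢 : LieGroupoid m n M Γ) (p q : ℕ) (V : Type*)
    [NormedAddCommGroup V] [NormedSpace ℝ V] : Submodule ℝ (𝒢.FormFamily p q V) where
  carrier := {θ | θ.IsForm}
  add_mem' {θ η} hθ hη := ⟨fun k P ↦ (hθ.contDiff k P).add (hη.contDiff k P),
    fun k l P f hf u ↦ by
      simp only [Pi.add_apply, hθ.comp k l P f hf u, hη.comp k l P f hf u]; rfl⟩
  zero_mem' := ⟨fun _ _ ↦ contDiff_const, fun k l P f hf u ↦ by
    simp only [Pi.zero_apply]; rfl⟩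
  smul_mem' c θ hθ := ⟨fun k P ↦ (hθ.contDiff k P).const_smul c, fun k l P f hf u ↦ by
    simp only [Pi.smul_apply, hθ.comp k l P f hf u]; rfl⟩

/-- `Ω^p(N_q, V)`, the smooth `V`-valued differential forms of degree `p` on the manifold `N_q`.
A form `θ` is encoded by its pullbacks `P^*θ` along all smooth maps `P : ℝᵏ → N_q`, for all `k`:
these are smooth forms on `ℝᵏ` with `(P ∘ f)^*θ = f^*(P^*θ)` for every smooth `f : ℝˡ → ℝᵏ`, and on
a smooth manifold (which is covered by parametrizations by `ℝᵏ`) each such compatible family comes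
from exactly one smooth differential form. -/
def Form (𝒢 : LieGroupoid m n M Γ) (p q : ℕ) (V : Type*)
    [NormedAddCommGroup V] [NormedSpace ℝ V] : Type _ :=
  𝒢.formSubmodule p q V

instance (𝒢 : LieGroupoid m n M Γ) (p q : ℕ) : AddCommGroup (𝒢.Form p q V) :=
  inferInstanceAs (AddCommGroup (𝒢.formSubmodule p q V))

instance (𝒢 : LieGroupoid m n M Γ) (p q : ℕ) : Module ℝ (𝒢.Form p q V) :=
  inferInstanceAs (Module ℝ (𝒢.formSubmodule p q V))

theorem Form.isForm {𝒢 : LieGroupoid m n M Γ} {p q : ℕ} (θ : 𝒢.Form p q V) :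
    FormFamily.IsForm θ.1 := θ.2

theorem Form.ext {𝒢 : LieGroupoid m n M Γ} {p q : ℕ} {θ η : 𝒢.Form p q V}
    (h : ∀ k P u, θ.1 k P u = η.1 k P u) : θ = η :=
  Subtype.ext (funext fun k ↦ funext fun P ↦ funext fun u ↦ h k P u)

/-- The pullback of differential forms along a smooth map of nerves. -/
def Form.pullback {𝒢' : LieGroupoid m n' M Γ'} {𝒢 : LieGroupoid m n M Γ} {q q' : ℕ} (p : ℕ)
    (V : Type*) [NormedAddCommGroup V] [NormedSpace ℝ V]
    (F : 𝒢'.Simplex q → 𝒢.Simplex q') (hF : IsSmoothMap 𝒢' 𝒢 q q' F) :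
    𝒢.Form p q' V →ₗ[ℝ] 𝒢'.Form p q V where
  toFun θ := ⟨fun k P ↦ θ.1 k ⟨F ∘ P.1, hF k P⟩, FormFamily.IsForm.mk
    (fun k _ ↦ θ.isForm.contDiff k _)
    (fun k l P f hf u ↦ θ.isForm.comp k l ⟨F ∘ P.1, hF k P⟩ f hf u)⟩
  map_add' _ _ := rfl
  map_smul' _ _ := rfl

/-- The de Rham differential. -/
def Form.d {𝒢 : LieGroupoid m n M Γ} {p q : ℕ} : 𝒢.Form p q V →ₗ[ℝ] 𝒢.Form (p + 1) q V where
  toFun θ := ⟨fun k P ↦ extDeriv (θ.1 k P), FormFamily.IsForm.mk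
    (fun k P ↦ by
      have h : ContDiff ℝ ∞ (fderiv ℝ (θ.1 k P)) :=
        (θ.isForm.contDiff k P).fderiv_right le_rfl
      exact (ContinuousAlternatingMap.alternatizeUncurryFinCLM ℝ
        (EuclideanSpace ℝ (Fin k)) V).contDiff.comp h)
    (fun k l P f hf u ↦ by
      have h : θ.1 l (P.comp f hf) =
          fun u ↦ (θ.1 k P (f u)).compContinuousLinearMap (fderiv ℝ f u) :=
        funext (θ.isForm.comp k l P f hf)
      rw [h]
      refine extDeriv_pullback (r := ∞) ?_ hf.contDiffAt ?_
      · exact ((θ.isForm.contDiff k P).differentiable (by simp)).differentiableAt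
      · rw [minSmoothness_of_isRCLikeNormedField]; exact WithTop.coe_le_coe.2 le_top)⟩
  map_add' θ η := by
    refine Form.ext fun k P u ↦ ?_
    exact extDeriv_add ((θ.isForm.contDiff k P).differentiable (by simp)).differentiableAt
      ((η.isForm.contDiff k P).differentiable (by simp)).differentiableAt
  map_smul' c θ := by
    refine Form.ext fun k P u ↦ ?_
    exact extDeriv_smul c (θ.1 k P)

/-- The simplicial differential `∂ = (-1)^p ∑ᵢ (-1)^i dᵢ^*` on forms of degree `p`. -/
def Form.del {𝒢 : LieGroupoid m n M Γ} {p q : ℕ} : 𝒢.Form p q V →ₗ[ℝ] 𝒢.Form p (q + 1) V :=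
  (-1 : ℝ) ^ p • ∑ i : Fin (q + 2),
    (-1 : ℝ) ^ (i : ℕ) • Form.pullback p V (Simplex.face i) (𝒢.isSmoothMap_face q i)

/-- Application of a continuous linear map to the values of a form. -/
def Form.mapCoeff {𝒢 : LieGroupoid m n M Γ} {p q : ℕ} (L : V →L[ℝ] W) :
    𝒢.Form p q V →ₗ[ℝ] 𝒢.Form p q W where
  toFun θ := ⟨fun k P u ↦ L.compContinuousAlternatingMap (θ.1 k P u), FormFamily.IsForm.mk
    (fun k P ↦ (ContinuousLinearMap.compContinuousAlternatingMapCLM ℝ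
        (EuclideanSpace ℝ (Fin k)) V W (Fin p) L).contDiff.comp (θ.isForm.contDiff k P))
    (fun k l P f hf u ↦ by simp only [θ.isForm.comp k l P f hf u]; rfl)⟩
  map_add' θ η := by
    refine Form.ext fun k P u ↦ ?_; ext v; exact map_add L _ _
  map_smul' c θ := by
    refine Form.ext fun k P u ↦ ?_; ext v; exact map_smul L _ _

/-! ## The total complex -/

/-- Families of forms in all bidegrees: a family `c` has the component `c p q` in `Ω^p(N_q, V)`. -/
abbrev Cochain (𝒢 : LieGroupoid m n M Γ) (V : Type*) [NormedAddCommGroup V] [NormedSpace ℝ V] :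
    Type _ :=
  ∀ p q : ℕ, 𝒢.Form p q V

/-- The component in bidegree `(p, q)` of the de Rham differential of a family. -/
def dComponent {𝒢 : LieGroupoid m n M Γ} : ∀ p q : ℕ, 𝒢.Cochain V →ₗ[ℝ] 𝒢.Form p q V
  | 0, _ => 0
  | p + 1, q => Form.d ∘ₗ LinearMap.proj q ∘ₗ LinearMap.proj p

/-- The component in bidegree `(p, q)` of the simplicial differential of a family. -/
def delComponent {𝒢 : LieGroupoid m n M Γ} : ∀ p q : ℕ, 𝒢.Cochain V →ₗ[ℝ] 𝒢.Form p q V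
  | _, 0 => 0
  | p, q + 1 => Form.del ∘ₗ LinearMap.proj q ∘ₗ LinearMap.proj p

/-- The total differential `d + ∂`. -/
def totalD (𝒢 : LieGroupoid m n M Γ) (V : Type*) [NormedAddCommGroup V] [NormedSpace ℝ V] :
    𝒢.Cochain V →ₗ[ℝ] 𝒢.Cochain V :=
  LinearMap.pi fun p ↦ LinearMap.pi fun q ↦ dComponent p q + delComponent p q

/-- The total complex in degree `k`: the direct sum of the spaces `Ω^p(N_q, V)` with
`p + q = k`. -/
def Tot (𝒢 : LieGroupoid m n M Γ) (V : Type*) [NormedAddCommGroup V] [NormedSpace ℝ V] (k : ℕ) :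
    Submodule ℝ (𝒢.Cochain V) where
  carrier := {c | ∀ p q, p + q ≠ k → c p q = 0}
  add_mem' ha hb p q h := by simp [ha p q h, hb p q h]
  zero_mem' _ _ _ := rfl
  smul_mem' a c hc p q h := by simp [hc p q h]

/-- The cocycles of degree `k` in the total complex. -/
def Cocycles (𝒢 : LieGroupoid m n M Γ) (V : Type*) [NormedAddCommGroup V] [NormedSpace ℝ V]
    (k : ℕ) : Submodule ℝ (𝒢.Cochain V) :=
  𝒢.Tot V k ⊓ LinearMap.ker (𝒢.totalD V)

/-- The coboundaries of degree `k` in the total complex. -/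
def Coboundaries (𝒢 : LieGroupoid m n M Γ) (V : Type*) [NormedAddCommGroup V] [NormedSpace ℝ V] :
    ℕ → Submodule ℝ (𝒢.Cochain V)
  | 0 => ⊥
  | k + 1 => (𝒢.Tot V k).map (𝒢.totalD V)

/-- The de Rham cohomology `H^k(Γ, V)` of a Lie groupoid with coefficients in `V`: cocycles modulo
coboundaries. -/
abbrev Cohomology (𝒢 : LieGroupoid m n M Γ) (V : Type*) [NormedAddCommGroup V] [NormedSpace ℝ V]
    (k : ℕ) : Type _ :=
  𝒢.Cocycles V k ⧸ (𝒢.Coboundaries V k).submoduleOf (𝒢.Cocycles V k)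

/-- The cohomology class of a cocycle. -/
def Cohomology.mk {𝒢 : LieGroupoid m n M Γ} {k : ℕ} (c : 𝒢.Cocycles V k) : 𝒢.Cohomology V k :=
  Submodule.Quotient.mk c

/-- Application of a continuous linear map to the values of all components of a family. -/
def Cochain.mapCoeff {𝒢 : LieGroupoid m n M Γ} (L : V →L[ℝ] W) :
    𝒢.Cochain V →ₗ[ℝ] 𝒢.Cochain W :=
  LinearMap.pi fun p ↦ LinearMap.pi fun q ↦
    Form.mapCoeff L ∘ₗ LinearMap.proj q ∘ₗ LinearMap.proj p

theorem Form.d_mapCoeff {𝒢 : LieGroupoid m n M Γ} {p q : ℕ} (L : V →L[ℝ] W)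
    (θ : 𝒢.Form p q V) : Form.d (Form.mapCoeff L θ) = Form.mapCoeff L (Form.d θ) := by
  refine Form.ext fun k P u ↦ ?_; ext v
  have hd : DifferentiableAt ℝ (θ.1 k P) u :=
    ((θ.isForm.contDiff k P).differentiable (by simp)).differentiableAt
  have h := (ContinuousLinearMap.compContinuousAlternatingMapCLM ℝ
        (EuclideanSpace ℝ (Fin k)) V W (Fin p) L).hasFDerivAt.comp u hd.hasFDerivAt
  change extDeriv (fun u ↦ L.compContinuousAlternatingMap (θ.1 k P u)) u v =
    L (extDeriv (θ.1 k P) u v)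
  have h' : fderiv ℝ (fun u ↦ L.compContinuousAlternatingMap (θ.1 k P u)) u = _ := h.fderiv
  rw [extDeriv, extDeriv, h', ContinuousAlternatingMap.alternatizeUncurryFin_apply,
    ContinuousAlternatingMap.alternatizeUncurryFin_apply, map_sum]
  refine Finset.sum_congr rfl fun i _ ↦ ?_
  rw [map_zsmul]
  rfl

theorem Form.del_mapCoeff {𝒢 : LieGroupoid m n M Γ} {p q : ℕ} (L : V →L[ℝ] W)
    (θ : 𝒢.Form p q V) : Form.del (Form.mapCoeff L θ) = Form.mapCoeff L (Form.del θ) := by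
  simp only [Form.del, LinearMap.smul_apply, LinearMap.sum_apply, map_smul, map_sum]
  rfl

theorem totalD_mapCoeff {𝒢 : LieGroupoid m n M Γ} (L : V →L[ℝ] W) (c : 𝒢.Cochain V) :
    𝒢.totalD W (Cochain.mapCoeff L c) = Cochain.mapCoeff L (𝒢.totalD V c) := by
  funext p q
  change dComponent p q _ + delComponent p q _ =
    Form.mapCoeff L (dComponent p q c + delComponent p q c)
  rw [map_add]
  congr 1
  · cases p with
    | zero => exact (map_zero _).symm
    | succ p => exact Form.d_mapCoeff L (c p q)
  · cases q with
    | zero => exact (map_zero _).symm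
    | succ q => exact Form.del_mapCoeff L (c p q)

theorem mapCoeff_mem_Tot {𝒢 : LieGroupoid m n M Γ} (L : V →L[ℝ] W) {k : ℕ} {c : 𝒢.Cochain V}
    (hc : c ∈ 𝒢.Tot V k) : Cochain.mapCoeff L c ∈ 𝒢.Tot W k := fun p q h ↦ by
  change Form.mapCoeff L (c p q) = 0
  rw [hc p q h, map_zero]

theorem mapCoeff_mem_Cocycles {𝒢 : LieGroupoid m n M Γ} (L : V →L[ℝ] W) {k : ℕ}
    {c : 𝒢.Cochain V} (hc : c ∈ 𝒢.Cocycles V k) : Cochain.mapCoeff L c ∈ 𝒢.Cocycles W k :=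
  ⟨mapCoeff_mem_Tot L hc.1, by
    exact (totalD_mapCoeff L c).trans ((congrArg _ (LinearMap.mem_ker.1 hc.2)).trans (map_zero _))⟩

theorem mapCoeff_mem_Coboundaries {𝒢 : LieGroupoid m n M Γ} (L : V →L[ℝ] W) {k : ℕ}
    {c : 𝒢.Cochain V} (hc : c ∈ 𝒢.Coboundaries V k) :
    Cochain.mapCoeff L c ∈ 𝒢.Coboundaries W k := by
  cases k with
  | zero =>
    have h0 : c = 0 := hc
    rw [h0, map_zero]
    exact Submodule.zero_mem _
  | succ k =>
    obtain ⟨b, hb, rfl⟩ := hc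
    exact ⟨Cochain.mapCoeff L b, mapCoeff_mem_Tot L hb, totalD_mapCoeff L b⟩

/-- The map in cohomology induced by a continuous linear map of the coefficients. -/
def Cohomology.mapCoeff (𝒢 : LieGroupoid m n M Γ) (k : ℕ) (L : V →L[ℝ] W) :
    𝒢.Cohomology V k →ₗ[ℝ] 𝒢.Cohomology W k :=
  Submodule.mapQ _ _
    ((Cochain.mapCoeff L).restrict fun _ hc ↦ mapCoeff_mem_Cocycles L hc)
    fun _ hc ↦ mapCoeff_mem_Coboundaries L hc

/-- The canonical map `H^k(Γ) ⊗ V → H^k(Γ, V)`, with `[c] ⊗ v ↦ [c · v]`. -/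
def Cohomology.ofTensor (𝒢 : LieGroupoid m n M Γ) (V : Type*) [NormedAddCommGroup V]
    [NormedSpace ℝ V] (k : ℕ) : 𝒢.Cohomology ℝ k ⊗[ℝ] V →ₗ[ℝ] 𝒢.Cohomology V k :=
  TensorProduct.lift <| LinearMap.flip
    { toFun := fun v ↦ Cohomology.mapCoeff 𝒢 k (ContinuousLinearMap.toSpanSingleton ℝ v)
      map_add' := fun v w ↦ by
        refine LinearMap.ext fun x ↦ ?_
        obtain ⟨c, rfl⟩ := Submodule.Quotient.mk_surjective _ x
        refine congrArg Submodule.Quotient.mk (Subtype.ext ?_)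
        funext p q; refine Form.ext fun l P u ↦ ?_; ext e
        exact smul_add ((c.1 p q).1 l P u e) v w
      map_smul' := fun a v ↦ by
        refine LinearMap.ext fun x ↦ ?_
        obtain ⟨c, rfl⟩ := Submodule.Quotient.mk_surjective _ x
        refine congrArg Submodule.Quotient.mk (Subtype.ext ?_)
        funext p q; refine Form.ext fun l P u ↦ ?_; ext e
        exact smul_comm ((c.1 p q).1 l P u e) a v }

/-! ## Smooth 1-forms on the manifold of arrows -/

/-- A smooth `V`-valued 1-form on a manifold `N` of dimension `n`: a family of linear maps
`T_x N → V` for which the resulting function on the tangent bundle is smooth. -/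
structure OneForm (n : ℕ) (N : Type*) [TopologicalSpace N]
    [ChartedSpace (EuclideanSpace ℝ (Fin n)) N] [IsManifold (𝓡 n) ∞ N]
    (V : Type*) [NormedAddCommGroup V] [NormedSpace ℝ V] where
  toFun : ∀ x : N, TangentSpace (𝓡 n) x →L[ℝ] V
  contMDiff : ContMDiff (𝓡 n).tangent 𝓘(ℝ, V) ∞
    fun v : TangentBundle (𝓡 n) N ↦ toFun v.proj v.2

/-- The pullback `f^*α` of a 1-form `α` along a map `f : ℝᵏ → N`. -/
def OneForm.pull {N : Type*} [TopologicalSpace N] [ChartedSpace (EuclideanSpace ℝ (Fin n)) N]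
    [IsManifold (𝓡 n) ∞ N] (α : OneForm n N V) {k : ℕ} (f : EuclideanSpace ℝ (Fin k) → N)
    (u : EuclideanSpace ℝ (Fin k)) : EuclideanSpace ℝ (Fin k) →L[ℝ] V :=
  (α.toFun (f u)).comp (mfderiv (𝓡 k) (𝓡 n) f u)

theorem OneForm.contDiff_pull {N : Type*} [TopologicalSpace N]
    [ChartedSpace (EuclideanSpace ℝ (Fin n)) N] [IsManifold (𝓡 n) ∞ N] (α : OneForm n N V) {k : ℕ}
    (f : EuclideanSpace ℝ (Fin k) → N) (hf : ContMDiff (𝓡 k) (𝓡 n) ∞ f) :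
    ContDiff ℝ ∞ (α.pull f) := by
  refine contDiff_clm_apply_iff.2 fun e ↦ ?_
  have h1 : ContMDiff (𝓡 k) (𝓡 k).tangent ∞
      (fun u ↦ (⟨u, e⟩ : TangentBundle (𝓡 k) (EuclideanSpace ℝ (Fin k)))) :=
    contMDiff_vectorSpace_iff_contDiff.2 contDiff_const
  have h2 : ContMDiff (𝓡 k).tangent (𝓡 n).tangent ∞ (tangentMap (𝓡 k) (𝓡 n) f) :=
    hf.contMDiff_tangentMap le_rfl
  exact (α.contMDiff.comp (h2.comp h1)).contDiff

theorem OneForm.pull_comp {N : Type*} [TopologicalSpace N]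
    [ChartedSpace (EuclideanSpace ℝ (Fin n)) N] [IsManifold (𝓡 n) ∞ N] (α : OneForm n N V)
    {k l : ℕ} (P : EuclideanSpace ℝ (Fin k) → N) (hP : ContMDiff (𝓡 k) (𝓡 n) ∞ P)
    (f : EuclideanSpace ℝ (Fin l) → EuclideanSpace ℝ (Fin k)) (hf : ContDiff ℝ ∞ f)
    (u : EuclideanSpace ℝ (Fin l)) :
    α.pull (P ∘ f) u = (α.pull P (f u)).comp (fderiv ℝ f u) := by
  unfold OneForm.pull
  rw [mfderiv_comp u (hP.mdifferentiableAt (by simp))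
    ((hf.differentiable (by simp)).differentiableAt.mdifferentiableAt), mfderiv_eq_fderiv]
  rfl

/-- A 1-form on the manifold `Γ` of arrows, as an element of `Ω¹(N₁)`. Here `Γ` is identified with
`N₁` through `σ ↦ σ.hom 0 1`. -/
def OneForm.toForm [IsManifold (𝓡 n) ∞ Γ] (𝒢 : LieGroupoid m n M Γ) (α : OneForm n Γ V) :
    𝒢.Form 1 1 V :=
  ⟨fun k P u ↦ ContinuousAlternatingMap.ofSubsingleton ℝ (EuclideanSpace ℝ (Fin k)) V (0 : Fin 1)
      (α.pull (fun u ↦ (P.1 u).hom 0 1) u), FormFamily.IsForm.mk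
    (fun k P ↦ (ContinuousAlternatingMap.ofSubsingletonLIE (𝕜 := ℝ)
      (E := EuclideanSpace ℝ (Fin k)) (F := V) (0 : Fin 1)).contDiff.comp (α.contDiff_pull _ (P.2.2 0 1)))
    (fun k l P f hf u ↦ by
      have h := α.pull_comp (fun u ↦ (P.1 u).hom 0 1) (P.2.2 0 1) f hf u
      change ContinuousAlternatingMap.ofSubsingleton ℝ (EuclideanSpace ℝ (Fin l)) V (0 : Fin 1)
        (α.pull ((fun u ↦ (P.1 u).hom 0 1) ∘ f) u) = _
      rw [h]
      rfl)⟩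

/-- A 1-form on the manifold of arrows, as an element of degree `2` of the total complex. -/
def OneForm.toCochain [IsManifold (𝓡 n) ∞ Γ] (𝒢 : LieGroupoid m n M Γ) (α : OneForm n Γ V) :
    𝒢.Cochain V :=
  Pi.single 1 (Pi.single 1 (α.toForm 𝒢))

end LieGroupoid

/-! ## Lie groups and their Lie algebras -/

section LieAlg

variable (r : ℕ) (G : Type*) [TopologicalSpace G] [ChartedSpace (EuclideanSpace ℝ (Fin r)) G]
  [Group G]

/-- The Lie algebra `𝔤` of a Lie group `G` of dimension `r`. -/
abbrev LieAlg : Type := GroupLieAlgebra (𝓡 r) G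

instance : NormedAddCommGroup (LieAlg r G) :=
  inferInstanceAs (NormedAddCommGroup (EuclideanSpace ℝ (Fin r)))

instance : NormedSpace ℝ (LieAlg r G) :=
  inferInstanceAs (NormedSpace ℝ (EuclideanSpace ℝ (Fin r)))

instance : FiniteDimensional ℝ (LieAlg r G) :=
  inferInstanceAs (FiniteDimensional ℝ (EuclideanSpace ℝ (Fin r)))

variable {G} in
/-- The adjoint action `Ad_g` of a Lie group on its Lie algebra: the derivative at `1` of the
conjugation by `g`. -/
def lieAd (g : G) : LieAlg r G →L[ℝ] LieAlg r G :=
  mfderiv (𝓡 r) (𝓡 r) (fun h : G ↦ g * h * g⁻¹) 1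

variable [LieGroup (𝓡 r) ∞ G]

instance : LieGroup (𝓡 r) (minSmoothness ℝ 3) G := by
  rw [minSmoothness_of_isRCLikeNormedField]
  exact LieGroup.of_le (n := ∞) (WithTop.coe_le_coe.2 le_top)

/-- A Lie group is reductive if its Lie algebra is reductive: each ideal of the Lie algebra has a
complementary ideal. -/
def IsReductiveLieGroup : Prop := ComplementedLattice (LieIdeal ℝ (LieAlg r G))

/-- The center `𝔷(𝔤)` of the Lie algebra. -/
abbrev lieCenter : Submodule ℝ (LieAlg r G) := (LieAlgebra.center ℝ (LieAlg r G)).toSubmodule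

/-- The derived ideal `[𝔤, 𝔤]` of the Lie algebra. -/
abbrev lieDerived : Submodule ℝ (LieAlg r G) :=
  (⁅(⊤ : LieIdeal ℝ (LieAlg r G)), (⊤ : LieIdeal ℝ (LieAlg r G))⁆).toSubmodule

theorem isCompl_center_derived {L : Type*} [LieRing L] [LieAlgebra ℝ L] [ComplementedLattice (LieIdeal ℝ L)] :
    IsCompl (LieAlgebra.center ℝ L).toSubmodule
      (⁅(⊤ : LieIdeal ℝ L), (⊤ : LieIdeal ℝ L)⁆).toSubmodule := by
  set Z := LieAlgebra.center ℝ L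
  set D := ⁅(⊤ : LieIdeal ℝ L), (⊤ : LieIdeal ℝ L)⁆ with hD
  have central : ∀ A : LieIdeal ℝ L, Disjoint A D → A ≤ Z := by
    intro A hA x hx
    rw [LieModule.mem_maxTrivSubmodule]
    intro y
    have h1 : ⁅y, x⁆ ∈ A := lie_mem_right ℝ L A y x hx
    have h2 : ⁅y, x⁆ ∈ D := LieSubmodule.lie_mem_lie (LieSubmodule.mem_top y) (LieSubmodule.mem_top x)
    have := (disjoint_iff.1 hA) ▸ (LieSubmodule.mem_inf _ _ _).2 ⟨h1, h2⟩
    simpa using this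
  obtain ⟨A, hA⟩ := exists_isCompl D
  obtain ⟨B, hB⟩ := exists_isCompl Z
  have hDB : D ≤ B := by
    rw [hD, LieSubmodule.lieIdeal_oper_eq_span, LieSubmodule.lieSpan_le]
    rintro _ ⟨x, y, rfl⟩
    have hx : (x : L) ∈ Z ⊔ B := by rw [hB.sup_eq_top]; exact LieSubmodule.mem_top _
    have hy : (y : L) ∈ Z ⊔ B := by rw [hB.sup_eq_top]; exact LieSubmodule.mem_top _
    obtain ⟨z, hz, b, hb, hzb⟩ := (LieSubmodule.mem_sup _ _ _).1 hx
    have hz' : ⁅z, (y : L)⁆ = 0 := by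
      rw [← lie_skew, (LieModule.mem_maxTrivSubmodule ℝ L L z).1 hz, neg_zero]
    have : ⁅(x : L), (y : L)⁆ = ⁅b, (y : L)⁆ := by rw [← hzb, add_lie, hz', zero_add]
    change ⁅(x : L), (y : L)⁆ ∈ B
    rw [this]
    exact lie_mem_left ℝ L B b y hb
  have hZD : IsCompl Z D := by
    refine ⟨hB.disjoint.mono_right hDB, codisjoint_iff.2 (top_le_iff.1 ?_)⟩
    rw [← hA.sup_eq_top]
    exact sup_le le_sup_right ((central A hA.symm.disjoint).trans le_sup_left)
  exact (LieSubmodule.isCompl_toSubmodule).2 hZD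

variable {r G} in
/-- The projection `pr : 𝔤 → 𝔷(𝔤)` along the decomposition `𝔤 = 𝔷(𝔤) ⊕ [𝔤, 𝔤]` into ideals of the
Lie algebra of a reductive Lie group. (By reductivity, `[𝔤, 𝔤]` is the only ideal which is
complementary to the center.) -/
def IsReductiveLieGroup.pr (h : IsReductiveLieGroup r G) : LieAlg r G →L[ℝ] lieCenter r G :=
  haveI : ComplementedLattice (LieIdeal ℝ (LieAlg r G)) := h
  LinearMap.toContinuousLinearMap (Submodule.projectionOnto (lieCenter r G) (lieDerived r G)
    isCompl_center_derived)

end LieAlg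

/-! ## Extensions -/

namespace LieGroupoid

variable {m n n' : ℕ} {M Γ Γ' : Type*}
  [TopologicalSpace M] [ChartedSpace (EuclideanSpace ℝ (Fin m)) M]
  [TopologicalSpace Γ] [ChartedSpace (EuclideanSpace ℝ (Fin n)) Γ]
  [TopologicalSpace Γ'] [ChartedSpace (EuclideanSpace ℝ (Fin n')) Γ']

/-- A `G`-extension `1 → M × G → Γ' → Γ → 1` of Lie groupoids over the identity map of `M`, where
`M × G` is the trivial bundle of groups over `M`. The morphism `φ : Γ' → Γ` is a surjective
submersion, and `i : M × G → Γ'` is an embedding onto the kernel of `φ`. -/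
structure GExtension (𝒢' : LieGroupoid m n' M Γ') (𝒢 : LieGroupoid m n M Γ) (r : ℕ) (G : Type*)
    [TopologicalSpace G] [ChartedSpace (EuclideanSpace ℝ (Fin r)) G] [Group G] where
  φ : Γ' → Γ
  i : M → G → Γ'
  src_φ : ∀ x, 𝒢.src (φ x) = 𝒢'.src x
  tgt_φ : ∀ x, 𝒢.tgt (φ x) = 𝒢'.tgt x
  φ_mul : ∀ x y, 𝒢'.src x = 𝒢'.tgt y → φ (𝒢'.mul x y) = 𝒢.mul (φ x) (φ y)
  φ_surjective : Function.Surjective φ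
  φ_isSubmersion : Manifold.IsSubmersion (𝓡 n') (𝓡 n) ∞ φ
  src_i : ∀ a g, 𝒢'.src (i a g) = a
  tgt_i : ∀ a g, 𝒢'.tgt (i a g) = a
  i_mul : ∀ a g h, i a (g * h) = 𝒢'.mul (i a g) (i a h)
  i_isSmoothEmbedding : Manifold.IsSmoothEmbedding ((𝓡 m).prod (𝓡 r)) (𝓡 n') ∞
    fun p : M × G ↦ i p.1 p.2
  exact : ∀ x, (∃ a, φ x = 𝒢.one a) ↔ ∃ a g, x = i a g

namespace GExtension

variable {r : ℕ} {G : Type*} [TopologicalSpace G] [ChartedSpace (EuclideanSpace ℝ (Fin r)) G]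
  [Group G] {𝒢' : LieGroupoid m n' M Γ'} {𝒢 : LieGroupoid m n M Γ}

/-- The right action `x ↦ x g` of `G` on `Γ'`: multiplication on the right by `i (src x, g)`. -/
def act (X : GExtension 𝒢' 𝒢 r G) (g : G) (x : Γ') : Γ' :=
  𝒢'.mul x (X.i (𝒢'.src x) g)

/-- The left action `x ↦ g x` of `G` on `Γ'`: multiplication on the left by `i (tgt x, g)`. -/
def leftAct (X : GExtension 𝒢' 𝒢 r G) (g : G) (x : Γ') : Γ' :=
  𝒢'.mul (X.i (𝒢'.tgt x) g) x

theorem i_one (X : GExtension 𝒢' 𝒢 r G) (a : M) : X.i a 1 = 𝒢'.one a := by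
  set e := X.i a 1
  have hs : 𝒢'.src e = a := X.src_i a 1
  have ht : 𝒢'.tgt e = a := X.tgt_i a 1
  have he : 𝒢'.mul e e = e := by rw [← X.i_mul, _root_.mul_one]
  have h := 𝒢'.mul_assoc (𝒢'.inv e) e e (by rw [𝒢'.src_inv]) (by rw [hs, ht])
  rw [he, 𝒢'.inv_mul, hs] at h
  rw [← h]
  conv_rhs => rw [← ht]
  rw [ht]
  conv_lhs => rw [← 𝒢'.one_mul e, ht]

theorem act_one (X : GExtension 𝒢' 𝒢 r G) (x : Γ') : X.act 1 x = x := by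
  rw [act, i_one, 𝒢'.mul_one]

theorem act_act (X : GExtension 𝒢' 𝒢 r G) (g h : G) (x : Γ') :
    X.act h (X.act g x) = X.act (g * h) x := by
  have hs : 𝒢'.src (𝒢'.mul x (X.i (𝒢'.src x) g)) = 𝒢'.src x := by
    rw [𝒢'.src_mul _ _ (X.tgt_i _ _).symm, X.src_i]
  rw [act, act, act, hs, X.i_mul, 𝒢'.mul_assoc _ _ _ (X.tgt_i _ _).symm
    ((X.src_i _ _).trans (X.tgt_i _ _).symm)]

/-- The orbit equivalence relation of the right action of the center `Z(G)` on `Γ'`. -/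
def centerSetoid (X : GExtension 𝒢' 𝒢 r G) : Setoid Γ' where
  r x y := ∃ z ∈ Subgroup.center G, y = X.act z x
  iseqv :=
    { refl := fun x ↦ ⟨1, Subgroup.one_mem _, (X.act_one x).symm⟩
      symm := by
        rintro x y ⟨z, hz, rfl⟩
        exact ⟨z⁻¹, Subgroup.inv_mem _ hz, by rw [act_act, mul_inv_cancel, act_one]⟩
      trans := by
        rintro x y w ⟨z, hz, rfl⟩ ⟨z', hz', rfl⟩
        exact ⟨z * z', Subgroup.mul_mem _ hz hz', X.act_act z z' x⟩ }

/-- The extension is central: with `q : Γ' → Γ'/Z(G)` the projection, there is a smooth section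
`σ : Γ → Γ'/Z(G)` of the map `Γ'/Z(G) → Γ` induced by `φ`, such that `x g = g x` for all `g ∈ G`
and all `x ∈ q⁻¹(σ(Γ))`. As `q` is a principal `Z(G)`-bundle, smoothness of `σ` means that `σ`
locally has the form `q ∘ τ` with `τ` a smooth map to `Γ'`. -/
def IsCentral (X : GExtension 𝒢' 𝒢 r G) : Prop :=
  ∃ σ : Γ → Quotient X.centerSetoid,
    (∀ γ x, Quotient.mk X.centerSetoid x = σ γ → X.φ x = γ) ∧
    (∀ γ₀, ∃ U : Set Γ, IsOpen U ∧ γ₀ ∈ U ∧ ∃ τ : Γ → Γ', ContMDiffOn (𝓡 n) (𝓡 n') ∞ τ U ∧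
      ∀ γ ∈ U, Quotient.mk X.centerSetoid (τ γ) = σ γ) ∧
    ∀ x, Quotient.mk X.centerSetoid x ∈ Set.range σ → ∀ g : G, X.act g x = X.leftAct g x

/-- Connection 1-forms on the right principal `G`-bundle `φ : Γ' → Γ`: the smooth `𝔤`-valued
1-forms `α` with `R_g^*α = Ad_{g⁻¹} ∘ α` for all `g ∈ G` and `α(ξ̂_x) = ξ` for all `ξ ∈ 𝔤`, where
`ξ̂_x` is the image of `ξ` under the derivative at `1` of the orbit map `g ↦ x g`. -/
structure IsConnection [IsManifold (𝓡 n') ∞ Γ'] (X : GExtension 𝒢' 𝒢 r G)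
    (α : OneForm n' Γ' (LieAlg r G)) : Prop where
  equivariant : ∀ (g : G) (x : Γ') (v : TangentSpace (𝓡 n') x),
    α.toFun (X.act g x) (mfderiv (𝓡 n') (𝓡 n') (X.act g) x v) = lieAd r g⁻¹ (α.toFun x v)
  vertical : ∀ (x : Γ') (ξ : LieAlg r G),
    α.toFun (X.act 1 x) (mfderiv (𝓡 r) (𝓡 n') (fun g ↦ X.act g x) 1 ξ) = ξ

theorem φ_contMDiff [IsManifold (𝓡 n') ∞ Γ'] [IsManifold (𝓡 n) ∞ Γ]
    (X : GExtension 𝒢' 𝒢 r G) : ContMDiff (𝓡 n') (𝓡 n) ∞ X.φ :=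
  X.φ_isSubmersion.contMDiff

/-- The map `N_q(Γ') → N_q(Γ)` induced by `φ`. -/
def nerveMap (X : GExtension 𝒢' 𝒢 r G) (q : ℕ) (σ : 𝒢'.Simplex q) : 𝒢.Simplex q where
  obj := σ.obj
  hom a b := X.φ (σ.hom a b)
  tgt_hom a b := by rw [X.tgt_φ, σ.tgt_hom]
  src_hom a b := by rw [X.src_φ, σ.src_hom]
  hom_mul_hom a b c := by
    rw [← X.φ_mul _ _ (by rw [σ.src_hom, σ.tgt_hom]), σ.hom_mul_hom]

theorem isSmoothMap_nerveMap [IsManifold (𝓡 n') ∞ Γ'] [IsManifold (𝓡 n) ∞ Γ]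
    (X : GExtension 𝒢' 𝒢 r G) (q : ℕ) : IsSmoothMap 𝒢' 𝒢 q q (X.nerveMap q) :=
  fun _ P ↦ ⟨P.2.1, fun a b ↦ X.φ_contMDiff.comp (P.2.2 a b)⟩

/-- The pullback `φ^*` on the families of forms in all bidegrees. -/
def pullback [IsManifold (𝓡 n') ∞ Γ'] [IsManifold (𝓡 n) ∞ Γ] (X : GExtension 𝒢' 𝒢 r G)
    (V : Type*) [NormedAddCommGroup V] [NormedSpace ℝ V] : 𝒢.Cochain V →ₗ[ℝ] 𝒢'.Cochain V :=
  LinearMap.pi fun p ↦ LinearMap.pi fun q ↦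
    Form.pullback p V (X.nerveMap q) (X.isSmoothMap_nerveMap q) ∘ₗ
      LinearMap.proj q ∘ₗ LinearMap.proj p

variable [IsManifold (𝓡 n') ∞ Γ'] [IsManifold (𝓡 n) ∞ Γ] [LieGroup (𝓡 r) ∞ G]

/-- The equation `pr(dα + ∂α) = φ^*Ω` in the total complex of `Γ'` with coefficients in `𝔷(𝔤)`. -/
def IsCurvatureOf (X : GExtension 𝒢' 𝒢 r G) (hG : IsReductiveLieGroup r G)
    (α : OneForm n' Γ' (LieAlg r G)) (Ω : 𝒢.Cochain (lieCenter r G)) : Prop :=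
  Cochain.mapCoeff hG.pr (𝒢'.totalD (LieAlg r G) (α.toCochain 𝒢')) =
    X.pullback (lieCenter r G) Ω

end GExtension

end LieGroupoid

end

/-!
The central part `a = pr ∘ α` of a connection form takes values in `𝔷(𝔤)`, and `pr` vanishes on
brackets. Let `θ` be the left Maurer–Cartan form of `G`. By the Maurer–Cartan equation `pr ∘ θ` is
closed (`extDeriv_maurerCartan`). Applied to products of local parametrizations of `G`, closedness
shows that `pr ∘ Ad_g` is locally constant in `g`, so `pr ∘ Ad_g = pr`, as `G` is connected
(`apply_lieAd_eq`). Therefore `g ↦ pr ∘ g^*θ` is additive on maps to `G`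
(`comp_maurerCartan_mul`).

A connection form satisfies `(x g)^*α = Ad_{g⁻¹} ∘ x^*α + g^*θ` for maps `x` to `Γ'` and `g` to `G`
(`pull_act`). So `a` changes by the closed form `pr ∘ g^*θ` under a change of lift `x ↦ x g`, and
`da` does not change. Neither does `∂a`: centrality gives `(x g) (y h) = (x y) (k⁻¹ g k h)` for a
map `k` to `G` which depends on `y` (`act_mul_act`), and additivity gives
`pr ∘ (k⁻¹ g k h)^*θ = pr ∘ g^*θ + pr ∘ h^*θ`.

Forms on the nerve are families indexed by plots, so descent along `φ` is a statement about
lifts of plots: by centrality, `φ` has local sections, hence each plot of the nerve of `Γ` lifts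
near each point (`IsCentral.exists_isLift`). So `φ^*` is injective, and its image consists of the
basic forms, which take equal values on any two lifts (`IsBasic.exists_pullbackForm_eq`). As `da`
and `∂a` are basic, `Ω` exists; as `φ^*` is injective, `Ω` is unique and inherits `(d + ∂) Ω = 0`.
The difference `a₁ - a₂` for two connection forms is unchanged by a change of lift, so it descends
to a form with total differential `Ω₁ - Ω₂`. The class of `Ω` comes from a unique element of
`H³(Γ) ⊗ 𝔷(𝔤)`, as the canonical map is bijective for finite-dimensional coefficients
(`Cohomology.ofTensor_bijective`).
-/

noncomputable section

/-! ### The Maurer–Cartan form -/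

section Calculus
open Manifold

/-- The chain rule for a map of two variables. -/
theorem mfderiv_comp_prodMk_apply {E M₁ M₂ N : Type*} {k₁ k₂ k₃ : ℕ}
    [NormedAddCommGroup E] [NormedSpace ℝ E]
    [TopologicalSpace M₁] [ChartedSpace (EuclideanSpace ℝ (Fin k₁)) M₁]
    [TopologicalSpace M₂] [ChartedSpace (EuclideanSpace ℝ (Fin k₂)) M₂]
    [TopologicalSpace N] [ChartedSpace (EuclideanSpace ℝ (Fin k₃)) N]
    {F : M₁ → M₂ → N} {a : E → M₁} {b : E → M₂} {u : E}
    (hF : MDifferentiableAt ((𝓡 k₁).prod (𝓡 k₂)) (𝓡 k₃) (fun p : M₁ × M₂ ↦ F p.1 p.2) (a u, b u))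
    (ha : MDifferentiableAt 𝓘(ℝ, E) (𝓡 k₁) a u) (hb : MDifferentiableAt 𝓘(ℝ, E) (𝓡 k₂) b u)
    (e : E) :
    mfderiv 𝓘(ℝ, E) (𝓡 k₃) (fun v ↦ F (a v) (b v)) u e =
      mfderiv (𝓡 k₁) (𝓡 k₃) (fun x ↦ F x (b u)) (a u) (mfderiv 𝓘(ℝ, E) (𝓡 k₁) a u e) +
      mfderiv (𝓡 k₂) (𝓡 k₃) (F (a u)) (b u) (mfderiv 𝓘(ℝ, E) (𝓡 k₂) b u e) := by
  have h := mfderiv_comp (I' := (𝓡 k₁).prod (𝓡 k₂)) u (f := fun v ↦ (a v, b v)) hF (ha.prodMk hb)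
  have h2 : mfderiv 𝓘(ℝ, E) (𝓡 k₃) (fun v ↦ F (a v) (b v)) u e = _ := DFunLike.congr_fun h e
  rw [h2, mfderiv_prodMk ha hb]
  exact mfderiv_prod_eq_add_apply hF

end Calculus

section MaurerCartan

variable {r : ℕ} {G : Type*} [TopologicalSpace G] [ChartedSpace (EuclideanSpace ℝ (Fin r)) G]
  [Group G] {E E' V : Type*} [NormedAddCommGroup E] [NormedSpace ℝ E]
  [NormedAddCommGroup E'] [NormedSpace ℝ E'] [NormedAddCommGroup V] [NormedSpace ℝ V]

/-- The pullback `g^*θ` of the left Maurer–Cartan form `θ` of a Lie group along `g : E → G`. At `u`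
it is the derivative of `v ↦ g(u)⁻¹ g(v)`, with values in the tangent space at
`g(u)⁻¹ g(u) = 1`. The result can be regarded as a map to the Lie algebra because all tangent
spaces are definitionally equal to the model space. -/
def maurerCartan (g : E → G) (u : E) : E →L[ℝ] LieAlg r G :=
  mfderiv 𝓘(ℝ, E) (𝓡 r) (fun v ↦ (g u)⁻¹ * g v) u

variable [LieGroup (𝓡 r) ∞ G]

theorem mdifferentiable_mul_left' (h : G) : MDifferentiable (𝓡 r) (𝓡 r) (fun x : G ↦ h * x) :=
  (contMDiff_mul_left (I := 𝓡 r) (n := ∞)).mdifferentiable (by simp)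

theorem differentiableAt_ofSubsingleton {f : E → E' →L[ℝ] V} {u : E} (hf : DifferentiableAt ℝ f u) :
    DifferentiableAt ℝ
      (fun v ↦ ContinuousAlternatingMap.ofSubsingleton ℝ E' V (0 : Fin 1) (f v)) u :=
  (ContinuousAlternatingMap.ofSubsingletonLIE (𝕜 := ℝ) (E := E') (F := V)
    (0 : Fin 1)).contDiff.differentiable (n := 1) one_ne_zero _ |>.comp u hf

omit [LieGroup (𝓡 r) ∞ G] in
theorem DifferentiableAt.const_clm_comp' {f : E → E' →L[ℝ] LieAlg r G} {u : E}
    (hf : DifferentiableAt ℝ f u) (ℓ : LieAlg r G →L[ℝ] V) :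
    DifferentiableAt ℝ (fun v ↦ ℓ.comp (f v)) u := by
  exact (differentiableAt_const ℓ).clm_comp hf

theorem maurerCartan_apply {g : E → G} {u : E} (hg : MDifferentiableAt 𝓘(ℝ, E) (𝓡 r) g u) (e : E) :
    maurerCartan g u e = mfderiv (𝓡 r) (𝓡 r) (fun x : G ↦ (g u)⁻¹ * x) (g u)
      (mfderiv 𝓘(ℝ, E) (𝓡 r) g u e) :=
  DFunLike.congr_fun (mfderiv_comp u (mdifferentiable_mul_left' (g u)⁻¹ (g u)) hg) e

theorem maurerCartan_comp {g : E → G} {f : E' → E} {u : E'}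
    (hg : MDifferentiableAt 𝓘(ℝ, E) (𝓡 r) g (f u)) (hf : DifferentiableAt ℝ f u) :
    maurerCartan (g ∘ f) u = (maurerCartan (r := r) g (f u)).comp (fderiv ℝ f u) := by
  have h := mfderiv_comp u (((mdifferentiable_mul_left' (g (f u))⁻¹ (g (f u))).comp (f u) hg))
    hf.mdifferentiableAt
  rw [mfderiv_eq_fderiv] at h
  exact h

omit [LieGroup (𝓡 r) ∞ G] in
theorem maurerCartan_congr {g h : E → G} {u : E} (H : g =ᶠ[nhds u] h) :
    maurerCartan (r := r) g u = maurerCartan h u := by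
  have H' : (fun v ↦ (g u)⁻¹ * g v) =ᶠ[nhds u] fun v ↦ (h u)⁻¹ * h v := by
    filter_upwards [H] with x hx
    rw [hx, H.self_of_nhds]
  exact H'.mfderiv_eq

omit [LieGroup (𝓡 r) ∞ G] in
theorem maurerCartan_const (h : G) (u : E) : maurerCartan (r := r) (fun _ : E ↦ h) u = 0 :=
  mfderiv_const

/-- `(gh)^*θ = Ad_{h⁻¹} ∘ g^*θ + h^*θ`. -/
theorem maurerCartan_mul {g h : E → G} {u : E} (hg : MDifferentiableAt 𝓘(ℝ, E) (𝓡 r) g u)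
    (hh : MDifferentiableAt 𝓘(ℝ, E) (𝓡 r) h u) (e : E) :
    maurerCartan (fun v ↦ g v * h v) u e =
      lieAd r (h u)⁻¹ (maurerCartan g u e) + maurerCartan h u e := by
  have hF : MDifferentiable ((𝓡 r).prod (𝓡 r)) (𝓡 r) (fun p : G × G ↦ (h u)⁻¹ * p.1 * p.2) :=
    ContMDiff.mdifferentiable (n := ∞)
      ((contMDiff_const.mul contMDiff_fst).mul contMDiff_snd) (by simp)
  have hgu := (mdifferentiable_mul_left' (g u)⁻¹ (g u)).comp u hg
  have key := mfderiv_comp_prodMk_apply (F := fun x y : G ↦ (h u)⁻¹ * x * y)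
    (a := fun v ↦ (g u)⁻¹ * g v) (b := h) (hF _) hgu hh e
  have h1 : (fun v ↦ (h u)⁻¹ * ((g u)⁻¹ * g v) * h v) = fun v ↦ (g u * h u)⁻¹ * (g v * h v) := by
    funext v; group
  have h2 : (fun v ↦ (h u)⁻¹ * ((g u)⁻¹ * g u) * v) = fun v ↦ (h u)⁻¹ * v := by
    funext v; group
  have h3 : (fun v ↦ (h u)⁻¹ * v * h u) = fun v ↦ (h u)⁻¹ * v * (h u)⁻¹⁻¹ := by
    funext v; group
  have k1 := congrArg
    (fun f : E → G ↦ (mfderiv 𝓘(ℝ, E) (𝓡 r) f u : E →L[ℝ] EuclideanSpace ℝ (Fin r)) e) h1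
  have k2 := congrArg
    (fun f : G → G ↦ (mfderiv (𝓡 r) (𝓡 r) f (h u) :
      EuclideanSpace ℝ (Fin r) →L[ℝ] EuclideanSpace ℝ (Fin r)) (mfderiv 𝓘(ℝ, E) (𝓡 r) h u e)) h2
  have k3 := congrArg
    (fun f : G → G ↦ (mfderiv (𝓡 r) (𝓡 r) f ((g u)⁻¹ * g u) :
      EuclideanSpace ℝ (Fin r) →L[ℝ] EuclideanSpace ℝ (Fin r)) (maurerCartan g u e)) h3
  have k4 := congrArg
    (fun x : G ↦ (mfderiv (𝓡 r) (𝓡 r) (fun v ↦ (h u)⁻¹ * v * (h u)⁻¹⁻¹) x :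
      EuclideanSpace ℝ (Fin r) →L[ℝ] EuclideanSpace ℝ (Fin r)) (maurerCartan g u e))
      (inv_mul_cancel (g u))
  refine k1.symm.trans (key.trans ?_)
  refine congrArg₂ (fun x y : EuclideanSpace ℝ (Fin r) ↦ x + y) (k3.trans k4) (k2.trans ?_)
  exact (maurerCartan_apply hh e).symm

theorem contDiffAt_maurerCartan {g : E → G} {u : E} (hg : ContMDiffAt 𝓘(ℝ, E) (𝓡 r) ∞ g u) :
    ContDiffAt ℝ ∞ (maurerCartan (r := r) g) u := by
  have h1 : ContMDiffAt (𝓘(ℝ, E).prod 𝓘(ℝ, E)) (𝓡 r) ∞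
      (Function.uncurry fun x v ↦ (g x)⁻¹ * g v) (u, u) :=
    (ContMDiffAt.comp (u, u) hg contMDiffAt_fst).inv.mul
      (ContMDiffAt.comp (u, u) hg contMDiffAt_snd)
  have h2 := ContMDiffAt.mfderiv (fun x v ↦ (g x)⁻¹ * g v) id h1 contMDiffAt_id (m := ∞) le_rfl
  rw [contMDiffAt_iff_contDiffAt] at h2
  refine h2.congr_of_eventuallyEq (Filter.Eventually.of_forall fun x ↦ ?_)
  -- All derivatives lie over the base point `1`, so the coordinate changes are trivial.
  have key : ∀ a b : G, a = 1 → b = 1 → ∀ w : EuclideanSpace ℝ (Fin r),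
      (tangentBundleCore (𝓡 r) G).coordChange (achart _ a) (achart _ b) a w = w := by
    rintro _ _ rfl rfl w
    exact (tangentBundleCore (𝓡 r) G).coordChange_self _ _ (mem_chart_source _ _) w
  refine Eq.trans ?_ (inTangentCoordinates_eq (x₀ := u) (x := x) id (fun x ↦ (g x)⁻¹ * g x)
    (fun x ↦ mfderiv 𝓘(ℝ, E) (𝓡 r) (fun v ↦ (g x)⁻¹ * g v) x) (mem_chart_source E x)
    (by simp)).symm
  refine ContinuousLinearMap.ext fun e ↦ ?_
  have h3 : (tangentBundleCore 𝓘(ℝ, E) E).coordChange (achart E (id u)) (achart E (id x)) (id x) e =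
      e := by rw [TangentBundle.coordChange_model_space]; rfl
  exact ((key _ _ (inv_mul_cancel (g x)) (inv_mul_cancel (g u)) _).trans
    (congrArg (maurerCartan (r := r) g x) h3)).symm

theorem mfderiv_inv_mul_mulInvariantVectorField (x : G) (ξ : LieAlg r G) :
    mfderiv (𝓡 r) (𝓡 r) (fun y : G ↦ x⁻¹ * y) x (mulInvariantVectorField ξ x) = ξ := by
  have h := mfderiv_comp (1 : G) (mdifferentiable_mul_left' (r := r) x⁻¹ (x * 1))
    (mdifferentiable_mul_left' (r := r) x 1)
  have h2 : (fun y : G ↦ x⁻¹ * y) ∘ (fun y ↦ x * y) = id := by funext y; simp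
  have h3 := congrArg
    (fun f : G → G ↦ (mfderiv (𝓡 r) (𝓡 r) f 1 : LieAlg r G →L[ℝ] EuclideanSpace ℝ (Fin r)) ξ) h2
  have h4 : (mfderiv (𝓡 r) (𝓡 r) (id : G → G) 1 : LieAlg r G →L[ℝ] EuclideanSpace ℝ (Fin r)) ξ =
    ξ := by rw [mfderiv_id]; rfl
  have h5 := congrArg
    (fun z : G ↦ (mfderiv (𝓡 r) (𝓡 r) (fun y : G ↦ x⁻¹ * y) z :
      EuclideanSpace ℝ (Fin r) →L[ℝ] EuclideanSpace ℝ (Fin r)) (mulInvariantVectorField ξ x))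
    (mul_one x)
  exact (h5.symm.trans (DFunLike.congr_fun h ξ).symm).trans (h3.trans h4)

section LocalParametrization

variable (x₀ : G)

theorem contMDiffAt_extChartAt_symm' {y : EuclideanSpace ℝ (Fin r)}
    (hy : y ∈ (extChartAt (𝓡 r) x₀).target) :
    ContMDiffAt 𝓘(ℝ, EuclideanSpace ℝ (Fin r)) (𝓡 r) ∞ (extChartAt (𝓡 r) x₀).symm y :=
  (contMDiffOn_extChartAt_symm x₀).contMDiffAt ((isOpen_extChartAt_target x₀).mem_nhds hy)

theorem isInvertible_mfderiv_extChartAt_symm' {y : EuclideanSpace ℝ (Fin r)}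
    (hy : y ∈ (extChartAt (𝓡 r) x₀).target) :
    (mfderiv 𝓘(ℝ, EuclideanSpace ℝ (Fin r)) (𝓡 r) (extChartAt (𝓡 r) x₀).symm y).IsInvertible := by
  have h := isInvertible_mfderivWithin_extChartAt_symm (I := 𝓡 r) hy
  rwa [ModelWithCorners.range_eq_univ, mfderivWithin_univ] at h

/-- The left invariant vector field with value `ξ` at the identity, in the chart at `x₀`. -/
def invariantFieldInChart (ξ : LieAlg r G) :
    EuclideanSpace ℝ (Fin r) → EuclideanSpace ℝ (Fin r) :=
  VectorField.mpullback 𝓘(ℝ, EuclideanSpace ℝ (Fin r)) (𝓡 r) (extChartAt (𝓡 r) x₀).symm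
    (mulInvariantVectorField ξ)

theorem maurerCartan_invariantFieldInChart {y : EuclideanSpace ℝ (Fin r)}
    (hy : y ∈ (extChartAt (𝓡 r) x₀).target) (ξ : LieAlg r G) :
    maurerCartan (r := r) (extChartAt (𝓡 r) x₀).symm y (invariantFieldInChart x₀ ξ y) = ξ := by
  rw [maurerCartan_apply ((contMDiffAt_extChartAt_symm' x₀ hy).mdifferentiableAt (by simp))]
  have h1 : mfderiv 𝓘(ℝ, EuclideanSpace ℝ (Fin r)) (𝓡 r) (extChartAt (𝓡 r) x₀).symm y
      (invariantFieldInChart x₀ ξ y) =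
      mulInvariantVectorField ξ ((extChartAt (𝓡 r) x₀).symm y) :=
    ((isInvertible_mfderiv_extChartAt_symm' x₀ hy).inverse_apply_eq.1 rfl).symm
  rw [h1]
  exact mfderiv_inv_mul_mulInvariantVectorField _ _

theorem invariantFieldInChart_maurerCartan {y : EuclideanSpace ℝ (Fin r)}
    (hy : y ∈ (extChartAt (𝓡 r) x₀).target) (e : EuclideanSpace ℝ (Fin r)) :
    invariantFieldInChart x₀ (maurerCartan (r := r) (extChartAt (𝓡 r) x₀).symm y e) y = e := by
  let A : EuclideanSpace ℝ (Fin r) →ₗ[ℝ] EuclideanSpace ℝ (Fin r) :=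
    (maurerCartan (r := r) (extChartAt (𝓡 r) x₀).symm y : _ →L[ℝ] LieAlg r G).toLinearMap
  have hs : Function.Surjective A := fun ξ ↦ ⟨_, maurerCartan_invariantFieldInChart x₀ hy ξ⟩
  exact LinearMap.injective_iff_surjective.2 hs (maurerCartan_invariantFieldInChart x₀ hy _)

theorem differentiableAt_invariantFieldInChart {y : EuclideanSpace ℝ (Fin r)}
    (hy : y ∈ (extChartAt (𝓡 r) x₀).target) (ξ : LieAlg r G) :
    DifferentiableAt ℝ (invariantFieldInChart x₀ ξ) y := by
  have h := ContMDiffAt.mpullback_vectorField_preimage (m := 1)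
    ((contMDiffAt_mulInvariantVectorField (I := 𝓡 r) ξ).of_le (by
      rw [minSmoothness_of_isRCLikeNormedField]; exact one_le_two))
    (contMDiffAt_extChartAt_symm' x₀ hy) (isInvertible_mfderiv_extChartAt_symm' x₀ hy)
    (by rw [one_add_one_eq_two]; exact WithTop.coe_le_coe.2 le_top)
  exact (contMDiffAt_vectorSpace_iff_contDiffAt.1 h).differentiableAt one_ne_zero

theorem lieBracket_invariantFieldInChart {y : EuclideanSpace ℝ (Fin r)}
    (hy : y ∈ (extChartAt (𝓡 r) x₀).target) (ξ η : LieAlg r G) :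
    VectorField.lieBracket ℝ (invariantFieldInChart x₀ ξ) (invariantFieldInChart x₀ η) y =
      invariantFieldInChart x₀ ⁅ξ, η⁆ y := by
  have h := VectorField.mpullback_mlieBracket
    (mdifferentiableAt_mulInvariantVectorField (I := 𝓡 r) ξ)
    (mdifferentiableAt_mulInvariantVectorField (I := 𝓡 r) η)
    (contMDiffAt_extChartAt_symm' x₀ hy)
    (by rw [minSmoothness_of_isRCLikeNormedField]; exact WithTop.coe_le_coe.2 le_top)
  rw [← mulInvariantVector_mlieBracket] at h
  have h2 : ∀ A B : ∀ y : EuclideanSpace ℝ (Fin r), TangentSpace (𝓡 r) y,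
      VectorField.mlieBracket 𝓘(ℝ, EuclideanSpace ℝ (Fin r)) A B y =
        VectorField.lieBracket ℝ A B y := fun A B ↦ by
    rw [← VectorField.mlieBracketWithin_univ, VectorField.mlieBracketWithin_eq_lieBracketWithin]
    exact congrFun VectorField.lieBracketWithin_univ y
  exact (h2 _ _).symm.trans h.symm

/-- The Maurer–Cartan equation in a chart, for a linear functional which vanishes on brackets. -/
theorem extDeriv_maurerCartan_extChartAt_symm {ℓ : LieAlg r G →L[ℝ] V}
    (hℓ : ∀ ξ η : LieAlg r G, ℓ ⁅ξ, η⁆ = 0) {y : EuclideanSpace ℝ (Fin r)}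
    (hy : y ∈ (extChartAt (𝓡 r) x₀).target) :
    extDeriv (fun v ↦ ContinuousAlternatingMap.ofSubsingleton ℝ _ V (0 : Fin 1)
      (ℓ.comp (maurerCartan (r := r) (extChartAt (𝓡 r) x₀).symm v))) y = 0 := by
  have hd : DifferentiableAt ℝ (fun v ↦ ContinuousAlternatingMap.ofSubsingleton ℝ _ V (0 : Fin 1)
      (ℓ.comp (maurerCartan (r := r) (extChartAt (𝓡 r) x₀).symm v))) y :=
    differentiableAt_ofSubsingleton
      (((contDiffAt_maurerCartan (contMDiffAt_extChartAt_symm' x₀ hy)).differentiableAt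
        (by simp)).const_clm_comp' ℓ)
  have hconst : ∀ ξ : LieAlg r G, fderiv ℝ (fun z ↦
      ℓ (maurerCartan (r := r) (extChartAt (𝓡 r) x₀).symm z (invariantFieldInChart x₀ ξ z))) y =
      0 := fun ξ ↦ by
    have : (fun z ↦ ℓ (maurerCartan (r := r) (extChartAt (𝓡 r) x₀).symm z
        (invariantFieldInChart x₀ ξ z))) =ᶠ[nhds y] fun _ ↦ ℓ ξ := by
      filter_upwards [(isOpen_extChartAt_target x₀).mem_nhds hy] with z hz
      rw [maurerCartan_invariantFieldInChart x₀ hz]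
    rw [this.fderiv_eq, fderiv_fun_const]; rfl
  refine ContinuousAlternatingMap.ext fun w ↦ ?_
  set ξ : LieAlg r G := maurerCartan (r := r) (extChartAt (𝓡 r) x₀).symm y (w 0) with hξ
  set η : LieAlg r G := maurerCartan (r := r) (extChartAt (𝓡 r) x₀).symm y (w 1) with hη
  have hw : w = fun i ↦ ![invariantFieldInChart x₀ ξ, invariantFieldInChart x₀ η] i y := by
    funext i
    fin_cases i
    · exact (invariantFieldInChart_maurerCartan x₀ hy (w 0)).symm
    · exact (invariantFieldInChart_maurerCartan x₀ hy (w 1)).symm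
  rw [hw, extDeriv_apply_vectorField hd]
  · refine (congrArg₂ (· - ·) (Finset.sum_eq_zero fun i _ ↦ ?_)
      (Finset.sum_eq_zero fun i _ ↦ Finset.sum_eq_zero fun j _ ↦ ?_)).trans (sub_zero _)
    · fin_cases i
      · exact (congrArg (fun L : EuclideanSpace ℝ (Fin r) →L[ℝ] V ↦
          (-1 : ℤ) ^ 0 • L (invariantFieldInChart x₀ ξ y))
          (hconst η)).trans (smul_zero _)
      · exact (congrArg (fun L : EuclideanSpace ℝ (Fin r) →L[ℝ] V ↦
          (-1 : ℤ) ^ 1 • L (invariantFieldInChart x₀ η y))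
          (hconst ξ)).trans (smul_zero _)
    · obtain rfl := Subsingleton.elim (α := Fin 1) i 0
      obtain rfl := Subsingleton.elim (α := Fin 1) j 0
      have h : ℓ (maurerCartan (r := r) (extChartAt (𝓡 r) x₀).symm y (VectorField.lieBracket ℝ
          (invariantFieldInChart x₀ ξ) (invariantFieldInChart x₀ η) y)) = 0 := by
        rw [lieBracket_invariantFieldInChart x₀ hy, maurerCartan_invariantFieldInChart x₀ hy, hℓ]
      exact (congrArg _ h).trans (smul_zero _)
  · intro i
    fin_cases i
    · exact differentiableAt_invariantFieldInChart x₀ hy ξ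
    · exact differentiableAt_invariantFieldInChart x₀ hy η

end LocalParametrization

/-- The Maurer–Cartan equation for a linear functional which vanishes on brackets. -/
theorem extDeriv_maurerCartan {ℓ : LieAlg r G →L[ℝ] V} (hℓ : ∀ ξ η : LieAlg r G, ℓ ⁅ξ, η⁆ = 0)
    {g : E → G} {u : E} (hg : ContMDiffAt 𝓘(ℝ, E) (𝓡 r) ∞ g u) :
    extDeriv (fun v ↦ ContinuousAlternatingMap.ofSubsingleton ℝ E V (0 : Fin 1)
      (ℓ.comp (maurerCartan g v))) u = 0 := by
  set φ := extChartAt (𝓡 r) (g u)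
  have hy : φ (g u) ∈ φ.target := mem_extChartAt_target _
  obtain ⟨f, hf'⟩ : ∃ f : E → EuclideanSpace ℝ (Fin r), f = φ ∘ g := ⟨_, rfl⟩
  have hf : ContDiffAt ℝ ∞ f u := by
    rw [hf']; exact (ContMDiffAt.comp u contMDiffAt_extChartAt hg).contDiffAt
  have hfu : f u = φ (g u) := by rw [hf']; rfl
  have hsrc : ∀ᶠ v in nhds u, g v ∈ φ.source :=
    hg.continuousAt.eventually ((isOpen_extChartAt_source (g u)).mem_nhds (mem_extChartAt_source _))
  have hfd : ∀ᶠ v in nhds u, DifferentiableAt ℝ f v :=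
    ((hf.of_le (m := 1) (WithTop.coe_le_coe.2 le_top)).eventually (by simp)).mono
      fun v hv ↦ hv.differentiableAt one_ne_zero
  have key : (fun v ↦ ContinuousAlternatingMap.ofSubsingleton ℝ E V (0 : Fin 1)
      (ℓ.comp (maurerCartan g v))) =ᶠ[nhds u] fun v ↦
      (ContinuousAlternatingMap.ofSubsingleton ℝ _ V (0 : Fin 1)
        (ℓ.comp (maurerCartan (r := r) φ.symm (f v)))).compContinuousLinearMap
        (fderiv ℝ f v) := by
    filter_upwards [hsrc.eventually_nhds, hfd] with v hv hfv
    have h1 : g =ᶠ[nhds v] φ.symm ∘ f := by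
      filter_upwards [hv] with w hw
      rw [Function.comp_apply, hf']; exact (φ.left_inv hw).symm
    rw [maurerCartan_congr h1, maurerCartan_comp (g := φ.symm) (f := f)
      ((contMDiffAt_extChartAt_symm' (g u) (by
        rw [hf']; exact φ.map_source hv.self_of_nhds)).mdifferentiableAt (by simp)) hfv]
    rfl
  have hd : DifferentiableAt ℝ (fun y ↦ ContinuousAlternatingMap.ofSubsingleton ℝ _ V (0 : Fin 1)
      (ℓ.comp (maurerCartan (r := r) φ.symm y))) (f u) := by
    rw [hfu]
    exact differentiableAt_ofSubsingleton (((contDiffAt_maurerCartan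
      (contMDiffAt_extChartAt_symm' (g u) hy)).differentiableAt (by simp)).const_clm_comp' ℓ)
  rw [key.extDeriv_eq, extDeriv_pullback (r := ∞) hd hf
    (by rw [minSmoothness_of_isRCLikeNormedField]; exact WithTop.coe_le_coe.2 le_top),
    hfu, extDeriv_maurerCartan_extChartAt_symm (g u) hℓ hy]
  rfl

omit [LieGroup (𝓡 r) ∞ G] in
theorem lieAd_one : lieAd r (1 : G) = ContinuousLinearMap.id ℝ _ := by
  have h : (fun h : G ↦ 1 * h * 1⁻¹) = id := by funext h; simp
  refine ContinuousLinearMap.ext fun ξ ↦ ?_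
  refine (congrArg (fun f : G → G ↦
    (mfderiv (𝓡 r) (𝓡 r) f 1 : LieAlg r G →L[ℝ] EuclideanSpace ℝ (Fin r)) ξ) h).trans ?_
  rw [mfderiv_id]

/-- A closed 1-form has a symmetric derivative. -/
theorem fderiv_comm_of_extDeriv_eq_zero {η : E → E →L[ℝ] V} {u : E} (hη : DifferentiableAt ℝ η u)
    (h : extDeriv (fun v ↦ ContinuousAlternatingMap.ofSubsingleton ℝ E V (0 : Fin 1) (η v)) u = 0)
    (a b : E) : fderiv ℝ (fun v ↦ η v a) u b = fderiv ℝ (fun v ↦ η v b) u a := by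
  have h1 := DFunLike.congr_fun h ![b, a]
  rw [extDeriv_apply (differentiableAt_ofSubsingleton hη), Fin.sum_univ_two] at h1
  have h2 : (-1 : ℤ) ^ 0 • fderiv ℝ (fun v ↦ η v a) u b +
      (-1 : ℤ) ^ 1 • fderiv ℝ (fun v ↦ η v b) u a = 0 := h1
  rw [pow_zero, pow_one, one_smul, neg_smul, one_smul] at h2
  exact add_neg_eq_zero.1 h2

/-- A linear functional which vanishes on brackets is invariant under the adjoint action of a
connected Lie group: in a chart, the form `ℓ ∘ θ` of the product `(x, v) ↦ d x * c v` is closed,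
which says that `v ↦ ℓ (Ad_{c v⁻¹} ξ)` has zero derivative. -/
theorem apply_lieAd_eq [ConnectedSpace G] {ℓ : LieAlg r G →L[ℝ] V}
    (hℓ : ∀ ξ η : LieAlg r G, ℓ ⁅ξ, η⁆ = 0) (h : G) (ξ : LieAlg r G) :
    ℓ (lieAd r h ξ) = ℓ ξ := by
  have hlc : IsLocallyConstant fun h : G ↦ ℓ (lieAd r h⁻¹ ξ) := by
    rw [IsLocallyConstant.iff_eventually_eq]
    intro x₀
    set φ := extChartAt (𝓡 r) x₀
    set ψ := extChartAt (𝓡 r) (1 : G)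
    have hy : ψ 1 ∈ ψ.target := mem_extChartAt_target _
    have hx₀ : φ x₀ ∈ φ.target := mem_extChartAt_target _
    set a : EuclideanSpace ℝ (Fin r) := invariantFieldInChart (1 : G) ξ (ψ 1) with ha
    let Q : EuclideanSpace ℝ (Fin r) × EuclideanSpace ℝ (Fin r) → G :=
      fun p ↦ ψ.symm p.1 * φ.symm p.2
    have hψs := fun x (hx : x ∈ ψ.target) ↦ contMDiffAt_extChartAt_symm' (r := r) (1 : G) hx
    have hφs := fun x (hx : x ∈ φ.target) ↦ contMDiffAt_extChartAt_symm' (r := r) x₀ hx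
    have hQ : ∀ p, p.1 ∈ ψ.target → p.2 ∈ φ.target →
        ContMDiffAt 𝓘(ℝ, EuclideanSpace ℝ (Fin r) × EuclideanSpace ℝ (Fin r)) (𝓡 r) ∞ Q p :=
      fun p h1 h2 ↦ (ContMDiffAt.comp p (hψs _ h1) contDiffAt_fst.contMDiffAt).mul
        (ContMDiffAt.comp p (hφs _ h2) contDiffAt_snd.contMDiffAt)
    have hMC : ∀ p, p.1 ∈ ψ.target → p.2 ∈ φ.target → ∀ e,
        maurerCartan (r := r) Q p e = lieAd r (φ.symm p.2)⁻¹ (maurerCartan ψ.symm p.1 e.1) +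
          maurerCartan (r := r) φ.symm p.2 e.2 := fun p h1 h2 e ↦ by
      have m1 := (hψs _ h1).mdifferentiableAt (by simp)
      have m2 := (hφs _ h2).mdifferentiableAt (by simp)
      have k1 := maurerCartan_comp (g := ψ.symm) (f := Prod.fst) (u := p) m1 differentiableAt_fst
      have k2 := maurerCartan_comp (g := φ.symm) (f := Prod.snd) (u := p) m2 differentiableAt_snd
      rw [fderiv_fst] at k1
      rw [fderiv_snd] at k2
      have := maurerCartan_mul (g := ψ.symm ∘ Prod.fst) (h := φ.symm ∘ Prod.snd) (u := p)
        (m1.comp p differentiableAt_fst.mdifferentiableAt)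
        (m2.comp p differentiableAt_snd.mdifferentiableAt) e
      rw [k1, k2] at this
      exact this
    have hξ : maurerCartan (r := r) ψ.symm (ψ 1) a = ξ :=
      maurerCartan_invariantFieldInChart (1 : G) hy ξ
    have hk : ∀ v ∈ φ.target,
        HasFDerivAt (fun v ↦ ℓ (lieAd r (φ.symm v)⁻¹ ξ)) (0 : _ →L[ℝ] V) v := fun v hv ↦ by
      have hη : DifferentiableAt ℝ (fun p ↦ ℓ.comp (maurerCartan (r := r) Q p)) (ψ 1, v) :=
        ((contDiffAt_maurerCartan (hQ _ hy hv)).differentiableAt (by simp)).const_clm_comp' ℓ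
      have hη' := fun e ↦ (hη.clm_apply (differentiableAt_const e)).hasFDerivAt
      have hsym := fun b ↦ fderiv_comm_of_extDeriv_eq_zero hη
        (extDeriv_maurerCartan hℓ (hQ _ hy hv)) (a, 0) (0, b)
      have h0 := fun b ↦ HasFDerivAt.comp (f := fun e ↦ (e, v)) (ψ 1) (hη' (0, b))
        (hasFDerivAt_prodMk_left (ψ 1) v)
      have h1 : HasFDerivAt _ _ v := (hη' (a, 0)).comp v (hasFDerivAt_prodMk_right (ψ 1) v)
      have h0' := fun b ↦ (h0 b).congr_of_eventuallyEq
        (f₁ := fun _ ↦ ℓ (maurerCartan (r := r) φ.symm v b)) (by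
          filter_upwards [(isOpen_extChartAt_target (1 : G)).mem_nhds hy] with x hx
          simp [hMC (x, v) hx hv])
      have h1' := h1.congr_of_eventuallyEq (f₁ := fun v ↦ ℓ (lieAd r (φ.symm v)⁻¹ ξ)) (by
          filter_upwards [(isOpen_extChartAt_target x₀).mem_nhds hv] with w hw
          simp [hMC (ψ 1, w) hy hw, hξ])
      have hz : (fderiv ℝ (fun y ↦ (ℓ.comp (maurerCartan (r := r) Q y)) (a, 0)) (ψ 1, v)).comp
          (ContinuousLinearMap.inr ℝ _ _) = 0 := ContinuousLinearMap.ext fun b ↦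
        (hsym b).trans (DFunLike.congr_fun ((h0' b).unique (hasFDerivAt_const _ _)) a)
      rw [hz] at h1'
      exact h1'
    obtain ⟨ε, hε, hball⟩ := Metric.isOpen_iff.1 (isOpen_extChartAt_target x₀) _ hx₀
    have hcont : ∀ᶠ x in nhds x₀, x ∈ φ.source ∧ φ x ∈ Metric.ball (φ x₀) ε :=
      (Filter.eventually_of_mem (extChartAt_source_mem_nhds (I := 𝓡 r) x₀) fun _ h ↦ h).and
        ((continuousAt_extChartAt x₀).eventually (Metric.ball_mem_nhds _ hε))
    filter_upwards [hcont] with x hx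
    have := (convex_ball (φ x₀) ε).is_const_of_fderivWithin_eq_zero (𝕜 := ℝ)
      (f := fun v ↦ ℓ (lieAd r (φ.symm v)⁻¹ ξ))
      (fun v hv ↦ (hk v (hball hv)).differentiableAt.differentiableWithinAt)
      (fun v hv ↦ by
        rw [fderivWithin_of_isOpen Metric.isOpen_ball hv, (hk v (hball hv)).fderiv])
      hx.2 (Metric.mem_ball_self hε)
    have e1 : φ.symm (φ x) = x := φ.left_inv hx.1
    have e2 : φ.symm (φ x₀) = x₀ := extChartAt_to_inv x₀
    rwa [e1, e2] at this
  have h1 := hlc.apply_eq_of_isPreconnected isPreconnected_univ (Set.mem_univ h⁻¹)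
    (Set.mem_univ 1)
  simpa [lieAd_one] using h1

end MaurerCartan

section MaurerCartanFunctional

variable {r : ℕ} {G : Type*} [TopologicalSpace G] [ChartedSpace (EuclideanSpace ℝ (Fin r)) G]
  [Group G] [LieGroup (𝓡 r) ∞ G] [ConnectedSpace G]
  {E V : Type*} [NormedAddCommGroup E] [NormedSpace ℝ E] [NormedAddCommGroup V] [NormedSpace ℝ V]
  {ℓ : LieAlg r G →L[ℝ] V} (hℓ : ∀ ξ η : LieAlg r G, ℓ ⁅ξ, η⁆ = 0)
include hℓ

theorem comp_maurerCartan_mul {g h : E → G} {u : E} (hg : MDifferentiableAt 𝓘(ℝ, E) (𝓡 r) g u)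
    (hh : MDifferentiableAt 𝓘(ℝ, E) (𝓡 r) h u) :
    ℓ.comp (maurerCartan (fun v ↦ g v * h v) u) =
      ℓ.comp (maurerCartan g u) + ℓ.comp (maurerCartan h u) := by
  refine ContinuousLinearMap.ext fun e ↦ ?_
  simp only [add_apply, ContinuousLinearMap.comp_apply]
  rw [maurerCartan_mul hg hh, map_add, apply_lieAd_eq hℓ]

theorem comp_maurerCartan_conj_mul {g h k : E → G} {u : E}
    (hg : MDifferentiableAt 𝓘(ℝ, E) (𝓡 r) g u) (hh : MDifferentiableAt 𝓘(ℝ, E) (𝓡 r) h u)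
    (hk : ContMDiffAt 𝓘(ℝ, E) (𝓡 r) ∞ k u) :
    ℓ.comp (maurerCartan (fun v ↦ (k v)⁻¹ * (g v * k v) * h v) u) =
      ℓ.comp (maurerCartan g u) + ℓ.comp (maurerCartan h u) := by
  have hk' := hk.mdifferentiableAt (by simp)
  have hki : MDifferentiableAt 𝓘(ℝ, E) (𝓡 r) (fun v ↦ (k v)⁻¹) u :=
    hk.inv.mdifferentiableAt (by simp)
  have mul : ∀ {a b : E → G}, MDifferentiableAt 𝓘(ℝ, E) (𝓡 r) a u →
      MDifferentiableAt 𝓘(ℝ, E) (𝓡 r) b u → MDifferentiableAt 𝓘(ℝ, E) (𝓡 r) (fun v ↦ a v * b v) u :=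
    fun ha hb ↦ ((contMDiff_mul (𝓡 r) ∞).mdifferentiable (by simp) _).comp u (ha.prodMk hb)
  have h1 := comp_maurerCartan_mul hℓ hki hk'
  simp only [inv_mul_cancel, maurerCartan_const] at h1
  rw [comp_maurerCartan_mul hℓ (mul hki (mul hg hk')) hh,
    comp_maurerCartan_mul hℓ hki (mul hg hk'), comp_maurerCartan_mul hℓ hg hk']
  have h2 : ℓ.comp (maurerCartan (fun v ↦ (k v)⁻¹) u) + ℓ.comp (maurerCartan k u) = 0 :=
    h1.symm.trans (ContinuousLinearMap.comp_zero _)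
  rw [add_left_comm, h2, add_zero]

end MaurerCartanFunctional

/-! ### Groupoid identities -/

namespace LieGroupoid

section Groupoid

variable {m n : ℕ} {M Γ : Type*}
  [TopologicalSpace M] [ChartedSpace (EuclideanSpace ℝ (Fin m)) M]
  [TopologicalSpace Γ] [ChartedSpace (EuclideanSpace ℝ (Fin n)) Γ] (𝒢 : LieGroupoid m n M Γ)

theorem inv_mul_cancel_left' {x y : Γ} (h : 𝒢.src x = 𝒢.tgt y) :
    𝒢.mul (𝒢.inv x) (𝒢.mul x y) = y := by
  rw [← 𝒢.mul_assoc _ _ _ (𝒢.src_inv x) h, 𝒢.inv_mul, h, 𝒢.one_mul]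

theorem mul_inv_cancel_left' {x y : Γ} (h : 𝒢.tgt x = 𝒢.tgt y) :
    𝒢.mul x (𝒢.mul (𝒢.inv x) y) = y := by
  rw [← 𝒢.mul_assoc _ _ _ (𝒢.tgt_inv x).symm (by rw [𝒢.src_inv, h]), 𝒢.mul_inv, h, 𝒢.one_mul]

theorem mul_left_cancel' {x y z : Γ} (hy : 𝒢.src x = 𝒢.tgt y) (hz : 𝒢.src x = 𝒢.tgt z)
    (h : 𝒢.mul x y = 𝒢.mul x z) : y = z := by
  rw [← 𝒢.inv_mul_cancel_left' hy, h, 𝒢.inv_mul_cancel_left' hz]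

theorem eq_inv_of_mul_eq_one {x y : Γ} (h : 𝒢.src x = 𝒢.tgt y)
    (hxy : 𝒢.mul x y = 𝒢.one (𝒢.tgt x)) : y = 𝒢.inv x :=
  𝒢.mul_left_cancel' h (𝒢.tgt_inv x).symm (hxy.trans (𝒢.mul_inv x).symm)

variable {F N : Type*} [NormedAddCommGroup F] [NormedSpace ℝ F] {H : Type*} [TopologicalSpace H]
  {I : ModelWithCorners ℝ F H} [TopologicalSpace N] [ChartedSpace H N]

theorem contMDiffAt_mul' {x y : N → Γ} {u : N} (hx : ContMDiffAt I (𝓡 n) ∞ x u)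
    (hy : ContMDiffAt I (𝓡 n) ∞ y u) (h : ∀ᶠ v in nhds u, 𝒢.src (x v) = 𝒢.tgt (y v)) :
    ContMDiffAt I (𝓡 n) ∞ (fun v ↦ 𝒢.mul (x v) (y v)) u := by
  have h1 := (𝒢.contMDiffOn_mul (x u, y u) h.self_of_nhds).comp
    (s := {v | 𝒢.src (x v) = 𝒢.tgt (y v)}) (f := fun v ↦ (x v, y v)) u
    (hx.prodMk hy).contMDiffWithinAt (fun v hv ↦ hv)
  exact h1.contMDiffAt h

end Groupoid

end LieGroupoid

/-! ### The action of the structure group on an extension -/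

namespace LieGroupoid

namespace GExtension

variable {m n n' r : ℕ} {M Γ Γ' G : Type*}
  [TopologicalSpace M] [ChartedSpace (EuclideanSpace ℝ (Fin m)) M]
  [TopologicalSpace Γ] [ChartedSpace (EuclideanSpace ℝ (Fin n)) Γ]
  [TopologicalSpace Γ'] [ChartedSpace (EuclideanSpace ℝ (Fin n')) Γ']
  [TopologicalSpace G] [ChartedSpace (EuclideanSpace ℝ (Fin r)) G] [Group G]
  {𝒢' : LieGroupoid m n' M Γ'} {𝒢 : LieGroupoid m n M Γ} (X : GExtension 𝒢' 𝒢 r G)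

section Algebra

theorem src_act (g : G) (x : Γ') : 𝒢'.src (X.act g x) = 𝒢'.src x := by
  rw [act, 𝒢'.src_mul _ _ (X.tgt_i _ _).symm, X.src_i]

theorem tgt_act (g : G) (x : Γ') : 𝒢'.tgt (X.act g x) = 𝒢'.tgt x := by
  rw [act, 𝒢'.tgt_mul _ _ (X.tgt_i _ _).symm]

theorem φ_one (a : M) : X.φ (𝒢'.one a) = 𝒢.one a := by
  have h1 := X.φ_mul (𝒢'.one a) (𝒢'.one a) (by rw [𝒢'.src_one, 𝒢'.tgt_one])
  have h2 : 𝒢'.mul (𝒢'.one a) (𝒢'.one a) = 𝒢'.one a := by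
    have := 𝒢'.one_mul (𝒢'.one a)
    rwa [𝒢'.tgt_one] at this
  rw [h2] at h1
  have hs : 𝒢.src (X.φ (𝒢'.one a)) = a := by rw [X.src_φ, 𝒢'.src_one]
  have ht : 𝒢.tgt (X.φ (𝒢'.one a)) = a := by rw [X.tgt_φ, 𝒢'.tgt_one]
  refine 𝒢.mul_left_cancel' (x := X.φ (𝒢'.one a)) (by rw [hs, ht]) (by rw [hs, 𝒢.tgt_one]) ?_
  have := 𝒢.mul_one (X.φ (𝒢'.one a))
  rw [hs] at this
  rw [this, ← h1]

theorem φ_inv (x : Γ') : X.φ (𝒢'.inv x) = 𝒢.inv (X.φ x) := by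
  refine 𝒢.eq_inv_of_mul_eq_one (by rw [X.src_φ, X.tgt_φ, 𝒢'.tgt_inv]) ?_
  rw [← X.φ_mul _ _ (𝒢'.tgt_inv x).symm, 𝒢'.mul_inv, X.φ_one, X.tgt_φ]

theorem i_injective (a : M) : Function.Injective (X.i a) := fun g h hgh ↦ congrArg Prod.snd
  (X.i_isSmoothEmbedding.isEmbedding.injective (a₁ := (a, g)) (a₂ := (a, h)) hgh)

theorem act_left_injective (x : Γ') : Function.Injective fun g ↦ X.act g x := fun _ _ hgh ↦
  X.i_injective (𝒢'.src x)
    (𝒢'.mul_left_cancel' (X.tgt_i _ _).symm (X.tgt_i _ _).symm hgh)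

/-- The fibres of `φ` are the orbits of the right action of `G`. -/
theorem exists_eq_act {x y : Γ'} (h : X.φ x = X.φ y) : ∃ g, y = X.act g x := by
  have hs : 𝒢'.src x = 𝒢'.src y := by rw [← X.src_φ, ← X.src_φ, h]
  have ht : 𝒢'.tgt x = 𝒢'.tgt y := by rw [← X.tgt_φ, ← X.tgt_φ, h]
  have hc : 𝒢'.src (𝒢'.inv x) = 𝒢'.tgt y := by rw [𝒢'.src_inv, ht]
  obtain ⟨a, g, hag⟩ := (X.exact (𝒢'.mul (𝒢'.inv x) y)).1 ⟨𝒢'.src x, by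
    rw [X.φ_mul _ _ hc, X.φ_inv, ← h, 𝒢.inv_mul, X.src_φ]⟩
  have ha : a = 𝒢'.src x := by
    rw [← X.tgt_i a g, ← hag, 𝒢'.tgt_mul _ _ hc, 𝒢'.tgt_inv]
  refine ⟨g, ?_⟩
  rw [act, ← ha, ← hag, 𝒢'.mul_inv_cancel_left' ht]

theorem inv_mul_act (g : G) (x : Γ') : 𝒢'.mul (𝒢'.inv x) (X.act g x) = X.i (𝒢'.src x) g :=
  𝒢'.inv_mul_cancel_left' (X.tgt_i _ _).symm

theorem mul_act {x y : Γ'} (h : 𝒢'.src x = 𝒢'.tgt y) (g : G) :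
    𝒢'.mul x (X.act g y) = X.act g (𝒢'.mul x y) := by
  rw [act, act, 𝒢'.src_mul _ _ h, 𝒢'.mul_assoc _ _ _ h (X.tgt_i _ _).symm]

theorem act_mul {x y : Γ'} (h : 𝒢'.src x = 𝒢'.tgt y) (g : G) :
    𝒢'.mul (X.act g x) y = 𝒢'.mul x (X.leftAct g y) := by
  rw [act, leftAct, 𝒢'.mul_assoc _ _ _ (X.tgt_i _ _).symm ((X.src_i _ _).trans h), h]

theorem leftAct_act (g k : G) (y : Γ') : X.leftAct g (X.act k y) = X.act k (X.leftAct g y) := by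
  rw [leftAct, leftAct, X.tgt_act, X.mul_act (X.src_i _ _)]

/-- If `y` is a translate `y₀ k` of an arrow `y₀` which commutes with `G`, then
`(x g) (y h) = (x y) (k⁻¹ g k h)`. -/
theorem act_mul_act {x y y₀ : Γ'} (h : 𝒢'.src x = 𝒢'.tgt y) {k : G} (hy : y = X.act k y₀)
    (hy₀ : ∀ g, X.act g y₀ = X.leftAct g y₀) (g l : G) :
    𝒢'.mul (X.act g x) (X.act l y) = X.act (k⁻¹ * (g * k) * l) (𝒢'.mul x y) := by
  have h1 : y₀ = X.act k⁻¹ y := by rw [hy, act_act, mul_inv_cancel, act_one]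
  have h2 : X.leftAct g y = X.act (k⁻¹ * (g * k)) y := by
    conv_lhs => rw [hy, leftAct_act, ← hy₀, act_act, h1, act_act]
  rw [X.mul_act (by rw [src_act, h]), X.act_mul h, h2, X.mul_act h, act_act]

end Algebra

section Smooth

theorem contMDiff_act :
    ContMDiff ((𝓡 n').prod (𝓡 r)) (𝓡 n') ∞ fun p : Γ' × G ↦ X.act p.2 p.1 := fun p ↦
  𝒢'.contMDiffAt_mul' contMDiffAt_fst
    ((X.i_isSmoothEmbedding.contMDiff.comp
      ((𝒢'.isSubmersion_src.contMDiff.comp contMDiff_fst).prodMk contMDiff_snd)) p)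
    (Filter.Eventually.of_forall fun _ ↦ (X.tgt_i _ _).symm)

variable {E : Type*} [NormedAddCommGroup E] [NormedSpace ℝ E]

/-- The quotient of two smooth lifts of the same map to `Γ` is a smooth map to `G`. -/
theorem contMDiffAt_of_eq_act {x y : E → Γ'} {g : E → G} {u : E}
    (hx : ContMDiffAt 𝓘(ℝ, E) (𝓡 n') ∞ x u) (hy : ContMDiffAt 𝓘(ℝ, E) (𝓡 n') ∞ y u)
    (h : ∀ᶠ v in nhds u, y v = X.act (g v) (x v)) : ContMDiffAt 𝓘(ℝ, E) (𝓡 r) ∞ g u := by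
  have hsrc := 𝒢'.isSubmersion_src.contMDiff
  have h1 : ContMDiffAt 𝓘(ℝ, E) (𝓡 n') ∞ (fun v ↦ 𝒢'.mul (𝒢'.inv (x v)) (y v)) u :=
    𝒢'.contMDiffAt_mul' ((𝒢'.contMDiff_inv _).comp u hx) hy (h.mono fun v hv ↦ by
      rw [hv, 𝒢'.src_inv, X.tgt_act])
  have h2 : ContMDiffAt 𝓘(ℝ, E) (𝓡 n') ∞
      ((fun p : M × G ↦ X.i p.1 p.2) ∘ fun v ↦ (𝒢'.src (x v), g v)) u :=
    h1.congr_of_eventuallyEq (h.mono fun v hv ↦ by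
      simp only [Function.comp_apply, hv, X.inv_mul_act])
  have hF : ContinuousAt (fun v ↦ (𝒢'.src (x v), g v)) u :=
    X.i_isSmoothEmbedding.isEmbedding.continuousAt_iff.2 h2.continuousAt
  have h3 := (ContMDiffAt.iff_comp_isImmersionAt (f := fun v ↦ (𝒢'.src (x v), g v))
    (X.i_isSmoothEmbedding.isImmersion.isImmersionAt (𝒢'.src (x u), g u))).2 ⟨hF, h2⟩
  exact contMDiffAt_snd.comp u h3

variable [IsManifold (𝓡 n') ∞ Γ'] [LieGroup (𝓡 r) ∞ G]

/-- The transformation of a connection form under a change of lift by a map to `G`. -/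
theorem pull_act {α : OneForm n' Γ' (LieAlg r G)} (hα : X.IsConnection α) {k : ℕ}
    {x : EuclideanSpace ℝ (Fin k) → Γ'} {g : EuclideanSpace ℝ (Fin k) → G}
    {u : EuclideanSpace ℝ (Fin k)} (hx : MDifferentiableAt (𝓡 k) (𝓡 n') x u)
    (hg : MDifferentiableAt (𝓡 k) (𝓡 r) g u) (e : EuclideanSpace ℝ (Fin k)) :
    α.pull (fun v ↦ X.act (g v) (x v)) u e =
      lieAd r (g u)⁻¹ (α.pull x u e) + maurerCartan g u e := by
  have hA : MDifferentiable ((𝓡 n').prod (𝓡 r)) (𝓡 n') fun p : Γ' × G ↦ X.act p.2 p.1 :=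
    X.contMDiff_act.mdifferentiable (by simp)
  have key := mfderiv_comp_prodMk_apply (F := fun z h ↦ X.act h z) (hA (x u, g u)) hx hg e
  set z := X.act (g u) (x u) with hz
  have hAz : MDifferentiable (𝓡 r) (𝓡 n') fun h ↦ X.act h z := fun h ↦
    (hA (z, h)).comp h (mdifferentiableAt_const.prodMk mdifferentiableAt_id)
  have horb : (fun h ↦ X.act h (x u)) = (fun h ↦ X.act h z) ∘ fun h ↦ (g u)⁻¹ * h := by
    funext h
    rw [Function.comp_apply, hz, act_act, mul_inv_cancel_left]
  -- The tangent spaces at equal points are only definitionally equal as types to the model space,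
  -- so base points are moved inside functions with values in the model space.
  have k1 := congrArg (fun f : G → Γ' ↦ (mfderiv (𝓡 r) (𝓡 n') f (g u) :
    EuclideanSpace ℝ (Fin r) →L[ℝ] EuclideanSpace ℝ (Fin n')) (mfderiv (𝓡 k) (𝓡 r) g u e)) horb
  have k2 := DFunLike.congr_fun (mfderiv_comp (g u) (hAz ((g u)⁻¹ * g u))
    (mdifferentiable_mul_left' (g u)⁻¹ (g u))) (mfderiv (𝓡 k) (𝓡 r) g u e)
  have k3 := congrArg (fun h : G ↦ (mfderiv (𝓡 r) (𝓡 n') (fun h ↦ X.act h z) h :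
    EuclideanSpace ℝ (Fin r) →L[ℝ] EuclideanSpace ℝ (Fin n')) (maurerCartan g u e))
    (inv_mul_cancel (g u))
  have k4 : mfderiv (𝓡 r) (𝓡 n') (fun h ↦ X.act h z) ((g u)⁻¹ * g u)
      (mfderiv (𝓡 r) (𝓡 r) (fun h : G ↦ (g u)⁻¹ * h) (g u) (mfderiv (𝓡 k) (𝓡 r) g u e)) =
      mfderiv (𝓡 r) (𝓡 n') (fun h ↦ X.act h z) ((g u)⁻¹ * g u) (maurerCartan g u e) :=
    congrArg (mfderiv (𝓡 r) (𝓡 n') (fun h ↦ X.act h z) ((g u)⁻¹ * g u))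
      (maurerCartan_apply hg e).symm
  have k5 := congrArg (fun y : Γ' ↦ (α.toFun y : EuclideanSpace ℝ (Fin n') →L[ℝ] LieAlg r G)
    (mfderiv (𝓡 r) (𝓡 n') (fun h ↦ X.act h z) 1 (maurerCartan g u e))) (X.act_one z)
  refine (congrArg (α.toFun z) key).trans ((map_add (α.toFun z) _ _).trans
    (congrArg₂ (· + ·) (hα.equivariant (g u) (x u) _) ?_))
  refine (congrArg (α.toFun z) (k1.trans (k2.trans (k4.trans k3)))).trans ?_
  exact k5.symm.trans (hα.vertical z _)

/-- A functional of a connection form which vanishes on brackets changes, under a change of lift,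
by the same functional of the Maurer–Cartan form. -/
theorem comp_pull_act [ConnectedSpace G] {V : Type*} [NormedAddCommGroup V] [NormedSpace ℝ V]
    {ℓ : LieAlg r G →L[ℝ] V} (hℓ : ∀ ξ η : LieAlg r G, ℓ ⁅ξ, η⁆ = 0)
    {α : OneForm n' Γ' (LieAlg r G)} (hα : X.IsConnection α) {k : ℕ}
    {x : EuclideanSpace ℝ (Fin k) → Γ'} {g : EuclideanSpace ℝ (Fin k) → G}
    {u : EuclideanSpace ℝ (Fin k)} (hx : MDifferentiableAt (𝓡 k) (𝓡 n') x u)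
    (hg : MDifferentiableAt (𝓡 k) (𝓡 r) g u) :
    ℓ.comp (α.pull (fun v ↦ X.act (g v) (x v)) u) =
      ℓ.comp (α.pull x u) + ℓ.comp (maurerCartan g u) := by
  refine ContinuousLinearMap.ext fun e ↦ ?_
  simp only [add_apply, ContinuousLinearMap.comp_apply]
  rw [X.pull_act hα hx hg, map_add, apply_lieAd_eq hℓ]

end Smooth

end GExtension

end LieGroupoid

/-! ### The total complex of the nerve -/

namespace LieGroupoid

section Forms

variable {m n : ℕ} {M Γ V : Type*}
  [TopologicalSpace M] [ChartedSpace (EuclideanSpace ℝ (Fin m)) M]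
  [TopologicalSpace Γ] [ChartedSpace (EuclideanSpace ℝ (Fin n)) Γ]
  [NormedAddCommGroup V] [NormedSpace ℝ V] {𝒢 : LieGroupoid m n M Γ} {p q : ℕ}

/-- The value of a form at a point only depends on the germ of the plot. -/
theorem Form.comp_eventuallyEq_id (θ : 𝒢.Form p q V) {k : ℕ} (P : 𝒢.Plot q k)
    {f : EuclideanSpace ℝ (Fin k) → EuclideanSpace ℝ (Fin k)} (hf : ContDiff ℝ ∞ f)
    {u : EuclideanSpace ℝ (Fin k)} (hu : f =ᶠ[nhds u] id) :
    θ.1 k (P.comp f hf) u = θ.1 k P u := by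
  have h1 : fderiv ℝ f u = ContinuousLinearMap.id ℝ _ := hu.fderiv_eq.trans fderiv_id
  rw [θ.isForm.comp k k P f hf u, h1, hu.self_of_nhds]
  rfl

theorem Form.d_d (θ : 𝒢.Form p q V) : Form.d (Form.d θ) = 0 :=
  Form.ext fun k P u ↦ congrFun (extDeriv_extDeriv (θ.isForm.contDiff k P)
    (by rw [minSmoothness_of_isRCLikeNormedField]; exact WithTop.coe_le_coe.2 le_top)) u

variable {n' : ℕ} {Γ' : Type*} [TopologicalSpace Γ']
  [ChartedSpace (EuclideanSpace ℝ (Fin n')) Γ'] {𝒢' : LieGroupoid m n' M Γ'}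

theorem Form.d_pullback {q' : ℕ} (F : 𝒢'.Simplex q → 𝒢.Simplex q')
    (hF : IsSmoothMap 𝒢' 𝒢 q q' F) (θ : 𝒢.Form p q' V) :
    Form.d (Form.pullback p V F hF θ) = Form.pullback (p + 1) V F hF (Form.d θ) := rfl

theorem Form.del_apply (θ : 𝒢.Form p q V) : Form.del θ = (-1 : ℝ) ^ p • ∑ i : Fin (q + 2),
    (-1 : ℝ) ^ (i : ℕ) • Form.pullback p V (Simplex.face i) (𝒢.isSmoothMap_face q i) θ := by
  simp [Form.del]

theorem Form.d_del (θ : 𝒢.Form p q V) : Form.d (Form.del θ) = -Form.del (Form.d θ) := by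
  rw [Form.del_apply, Form.del_apply, map_smul, map_sum, pow_succ, mul_neg_one, neg_smul, neg_neg]
  simp only [map_smul, Form.d_pullback]

theorem Simplex.face_face (σ : 𝒢.Simplex (q + 2)) {i j : Fin (q + 2)} (h : i ≤ j) :
    (σ.face j.succ).face i = (σ.face i.castSucc).face j := by
  have key : ∀ a, j.succ.succAbove (i.succAbove a) = i.castSucc.succAbove (j.succAbove a) :=
    fun a ↦ by
      have := Fin.le_def.1 h
      ext
      simp only [Fin.succAbove, Fin.lt_def, Fin.val_castSucc, Fin.val_succ]
      grind
  ext <;> simp only [Simplex.face, key]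

theorem Form.del_del (θ : 𝒢.Form p q V) : Form.del (Form.del θ) = 0 := by
  -- The pullback along the composite of two faces, as a function of the two omitted vertices.
  let T : Fin (q + 3) → Fin (q + 2) → 𝒢.Form p (q + 2) V := fun j i ↦
    Form.pullback p V (Simplex.face j) (𝒢.isSmoothMap_face (q + 1) j)
      (Form.pullback p V (Simplex.face i) (𝒢.isSmoothMap_face q i) θ)
  have hT : ∀ i j : Fin (q + 2), i ≤ j → T j.succ i = T i.castSucc j := fun i j h ↦
    Form.ext fun k P u ↦ congrArg (fun Q : 𝒢.Plot q k ↦ θ.1 k Q u)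
      (Subtype.ext (funext fun v ↦ (P.1 v).face_face h))
  have key : ∑ j : Fin (q + 3), ∑ i : Fin (q + 2), (-1 : ℝ) ^ ((j : ℕ) + i) • T j i = 0 := by
    rw [Fin.sum_sum_eq_sum_triangle_add]
    refine Finset.sum_eq_zero fun i _ ↦ Finset.sum_eq_zero fun j hj ↦ ?_
    rw [hT i j (Finset.mem_Ici.1 hj)]
    simp only [Fin.val_castSucc, Fin.val_succ]
    rw [← add_smul]
    convert zero_smul ℝ _ using 2
    ring
  have h : Form.del (Form.del θ) = ((-1 : ℝ) ^ p * (-1) ^ p) •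
      ∑ j : Fin (q + 3), ∑ i : Fin (q + 2), (-1 : ℝ) ^ ((j : ℕ) + i) • T j i := by
    rw [Form.del_apply (Form.del θ), mul_smul]
    congr 1
    rw [Finset.smul_sum]
    refine Finset.sum_congr rfl fun j _ ↦ ?_
    rw [Form.del_apply θ, map_smul, map_sum, smul_comm, Finset.smul_sum]
    simp only [map_smul, smul_smul, pow_add, T]
  rw [h, key, smul_zero]

theorem totalD_totalD (c : 𝒢.Cochain V) : 𝒢.totalD V (𝒢.totalD V c) = 0 := by
  funext p q
  change dComponent p q _ + delComponent p q _ = 0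
  rcases p with _ | _ | p <;> rcases q with _ | _ | q
  all_goals simp [dComponent, delComponent, totalD, Form.d_d, Form.d_del, Form.del_del]

theorem mapCoeff_single {W : Type*} [NormedAddCommGroup W] [NormedSpace ℝ W] (L : V →L[ℝ] W)
    (θ : 𝒢.Form p q V) : Cochain.mapCoeff L (Pi.single p (Pi.single q θ) : 𝒢.Cochain V) =
      Pi.single p (Pi.single q (Form.mapCoeff L θ)) := by
  funext p' q'
  change Form.mapCoeff L _ = _
  by_cases hp : p' = p
  · subst hp
    by_cases hq : q' = q
    · subst hq; simp
    · simp [hq]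
  · simp [hp]

theorem single_mem_Tot (θ : 𝒢.Form p q V) :
    (Pi.single p (Pi.single q θ) : 𝒢.Cochain V) ∈ 𝒢.Tot V (p + q) := fun p' q' h ↦ by
  by_cases hp : p' = p
  · subst hp
    have hq : q' ≠ q := fun hq ↦ h (by rw [hq])
    simp [hq]
  · simp [hp]

theorem totalD_mem_Tot {c : 𝒢.Cochain V} {k : ℕ} (hc : c ∈ 𝒢.Tot V k) :
    𝒢.totalD V c ∈ 𝒢.Tot V (k + 1) := fun p q h ↦ by
  change dComponent p q _ + delComponent p q _ = 0
  have h1 : dComponent p q c = 0 := by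
    cases p with
    | zero => rfl
    | succ p => exact (congrArg Form.d (hc p q (by omega))).trans (map_zero _)
  have h2 : delComponent p q c = 0 := by
    cases q with
    | zero => rfl
    | succ q => exact (congrArg Form.del (hc p q (by omega))).trans (map_zero _)
  rw [h1, h2, add_zero]

end Forms

end LieGroupoid

/-! ### Lifts of plots and descent of forms -/

/-- Near `u` the identity can be continued to a smooth map into a given neighbourhood of `u`. -/
theorem exists_contDiff_eventuallyEq_id {E : Type*} [NormedAddCommGroup E] [InnerProductSpace ℝ E]
    {u : E} {O : Set E} (hO : O ∈ nhds u) :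
    ∃ f : E → E, ContDiff ℝ ∞ f ∧ f =ᶠ[nhds u] id ∧ ∀ v, f v ∈ O := by
  obtain ⟨ε, hε, hball⟩ := Metric.mem_nhds_iff.1 hO
  let χ : ContDiffBump u := ⟨ε / 2, ε, by positivity, by linarith⟩
  refine ⟨fun v ↦ u + χ v • (v - u), contDiff_const.add (χ.contDiff.smul (contDiff_id.sub
    contDiff_const)), ?_, fun v ↦ hball ?_⟩
  · filter_upwards [χ.eventuallyEq_one] with v hv
    simp [hv]
  · by_cases hv : dist v u < ε
    · rw [Metric.mem_ball, dist_eq_norm, add_sub_cancel_left, norm_smul, Real.norm_of_nonneg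
        χ.nonneg, ← dist_eq_norm]
      exact (mul_le_of_le_one_left dist_nonneg χ.le_one).trans_lt hv
    · simp [χ.zero_of_le_dist (not_lt.1 hv), hε]

namespace LieGroupoid

namespace GExtension

variable {m n n' r : ℕ} {M Γ Γ' G V : Type*}
  [TopologicalSpace M] [ChartedSpace (EuclideanSpace ℝ (Fin m)) M]
  [TopologicalSpace Γ] [ChartedSpace (EuclideanSpace ℝ (Fin n)) Γ] [IsManifold (𝓡 n) ∞ Γ]
  [TopologicalSpace Γ'] [ChartedSpace (EuclideanSpace ℝ (Fin n')) Γ'] [IsManifold (𝓡 n') ∞ Γ']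
  [TopologicalSpace G] [ChartedSpace (EuclideanSpace ℝ (Fin r)) G] [Group G]
  [NormedAddCommGroup V] [NormedSpace ℝ V]
  {𝒢' : LieGroupoid m n' M Γ'} {𝒢 : LieGroupoid m n M Γ} (X : GExtension 𝒢' 𝒢 r G) {p q : ℕ}

/-- The pullback along `φ` of forms on the nerve. -/
abbrev pullbackForm (V : Type*) [NormedAddCommGroup V] [NormedSpace ℝ V] (p q : ℕ) :
    𝒢.Form p q V →ₗ[ℝ] 𝒢'.Form p q V :=
  Form.pullback p V (X.nerveMap q) (X.isSmoothMap_nerveMap q)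

theorem del_pullbackForm (θ : 𝒢.Form p q V) :
    Form.del (X.pullbackForm V p q θ) = X.pullbackForm V p (q + 1) (Form.del θ) := by
  rw [Form.del_apply, Form.del_apply, map_smul, map_sum]
  simp only [map_smul]
  rfl

theorem totalD_pullback (c : 𝒢.Cochain V) :
    𝒢'.totalD V (X.pullback V c) = X.pullback V (𝒢.totalD V c) := by
  funext p q
  change dComponent p q _ + delComponent p q _ =
    X.pullbackForm V p q (dComponent p q c + delComponent p q c)
  rw [map_add]
  congr 1
  · cases p with
    | zero => exact (map_zero (X.pullbackForm V 0 q)).symm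
    | succ p => rfl
  · cases q with
    | zero => exact (map_zero (X.pullbackForm V p 0)).symm
    | succ q => exact X.del_pullbackForm (c p q)

omit [IsManifold (𝓡 n) ∞ Γ] [IsManifold (𝓡 n') ∞ Γ'] in
/-- A local smooth section of `φ` through each arrow of `Γ`, with values in the arrows which
commute with `G`. -/
theorem IsCentral.exists_section {X : GExtension 𝒢' 𝒢 r G} (hX : X.IsCentral) (γ₀ : Γ) :
    ∃ U : Set Γ, IsOpen U ∧ γ₀ ∈ U ∧ ∃ τ : Γ → Γ', ContMDiffOn (𝓡 n) (𝓡 n') ∞ τ U ∧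
      ∀ γ ∈ U, X.φ (τ γ) = γ ∧ ∀ g, X.act g (τ γ) = X.leftAct g (τ γ) := by
  obtain ⟨σ, h1, h2, h3⟩ := hX
  obtain ⟨U, hU, hγ, τ, hτ, h⟩ := h2 γ₀
  exact ⟨U, hU, hγ, τ, hτ, fun γ hγ ↦ ⟨h1 γ _ (h γ hγ), h3 _ ⟨γ, (h γ hγ).symm⟩⟩⟩

/-- `Q` is a lift of the plot `P` through `φ`. -/
def IsLift {k : ℕ} (Q : 𝒢'.Plot q k) (P : 𝒢.Plot q k) : Prop :=
  ∀ u, X.nerveMap q (Q.1 u) = P.1 u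

variable {X}

omit [IsManifold (𝓡 n) ∞ Γ] [IsManifold (𝓡 n') ∞ Γ'] in
theorem IsLift.comp {k l : ℕ} {Q : 𝒢'.Plot q k} {P : 𝒢.Plot q k} (h : X.IsLift Q P)
    {f : EuclideanSpace ℝ (Fin l) → EuclideanSpace ℝ (Fin k)} (hf : ContDiff ℝ ∞ f) :
    X.IsLift (Q.comp f hf) (P.comp f hf) := fun u ↦ h (f u)

theorem IsLift.pullbackForm_apply {k : ℕ} {Q : 𝒢'.Plot q k} {P : 𝒢.Plot q k} (h : X.IsLift Q P)
    (θ : 𝒢.Form p q V) : (X.pullbackForm V p q θ).1 k Q = θ.1 k P :=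
  congrArg (θ.1 k) (Subtype.ext (funext h))

omit [IsManifold (𝓡 n) ∞ Γ] [IsManifold (𝓡 n') ∞ Γ'] in
/-- After composition with a smooth map which is the identity near a given point, a plot of the
nerve of `Γ` lifts to the nerve of `Γ'`. If `x i` is a lift of the edge from the vertex `i` to the
vertex `0`, then the products `(x i)⁻¹ (x j)` are the edges of a lift of the simplex. -/
theorem IsCentral.exists_isLift (hX : X.IsCentral) {k : ℕ} (P : 𝒢.Plot q k)
    (u : EuclideanSpace ℝ (Fin k)) :
    ∃ (f : EuclideanSpace ℝ (Fin k) → EuclideanSpace ℝ (Fin k)) (hf : ContDiff ℝ ∞ f),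
      f =ᶠ[nhds u] id ∧ ∃ Q : 𝒢'.Plot q k, X.IsLift Q (P.comp f hf) := by
  choose U hU hmem τ hτ hφτ using fun i ↦ hX.exists_section ((P.1 u).hom 0 i)
  have hO : ⋂ i, {v | (P.1 v).hom 0 i ∈ U i} ∈ nhds u := Filter.iInter_mem.2 fun i ↦
    (P.2.2 0 i).continuous.continuousAt.preimage_mem_nhds ((hU i).mem_nhds (hmem i))
  obtain ⟨f, hf, hfu, hfO⟩ := exists_contDiff_eventuallyEq_id hO
  have hmem' : ∀ i v, (P.1 (f v)).hom 0 i ∈ U i := fun i v ↦ Set.mem_iInter.1 (hfO v) i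
  let x : Fin (q + 1) → EuclideanSpace ℝ (Fin k) → Γ' := fun i v ↦ τ i ((P.1 (f v)).hom 0 i)
  have hx : ∀ i, ContMDiff (𝓡 k) (𝓡 n') ∞ (x i) := fun i ↦
    (hτ i).comp_contMDiff ((P.2.2 0 i).comp hf.contMDiff) (hmem' i)
  have hφx : ∀ i v, X.φ (x i v) = (P.1 (f v)).hom 0 i := fun i v ↦ (hφτ i _ (hmem' i v)).1
  have hsrc : ∀ i v, 𝒢'.src (x i v) = (P.1 (f v)).obj i := fun i v ↦ by
    rw [← X.src_φ, hφx, Simplex.src_hom]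
  have htgt : ∀ i v, 𝒢'.tgt (x i v) = (P.1 (f v)).obj 0 := fun i v ↦ by
    rw [← X.tgt_φ, hφx, Simplex.tgt_hom]
  have hcomp : ∀ i j v, 𝒢'.src (𝒢'.inv (x i v)) = 𝒢'.tgt (x j v) := fun i j v ↦ by
    rw [𝒢'.src_inv, htgt, htgt]
  let Q : EuclideanSpace ℝ (Fin k) → 𝒢'.Simplex q := fun v ↦
    { obj := (P.1 (f v)).obj
      hom := fun i j ↦ 𝒢'.mul (𝒢'.inv (x i v)) (x j v)
      tgt_hom := fun i j ↦ by rw [𝒢'.tgt_mul _ _ (hcomp i j v), 𝒢'.tgt_inv, hsrc]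
      src_hom := fun i j ↦ by rw [𝒢'.src_mul _ _ (hcomp i j v), hsrc]
      hom_mul_hom := fun i j l ↦ by
        rw [𝒢'.mul_assoc _ _ _ (hcomp i j v)
          (by rw [𝒢'.tgt_mul _ _ (hcomp j l v), 𝒢'.tgt_inv]),
          𝒢'.mul_inv_cancel_left' (by rw [htgt, htgt])] }
  have hQ : 𝒢'.IsPlot q k Q := ⟨fun i ↦ (P.2.1 i).comp hf.contMDiff, fun i j v ↦
    𝒢'.contMDiffAt_mul' ((𝒢'.contMDiff_inv.comp (hx i)) v) (hx j v)
      (Filter.Eventually.of_forall (hcomp i j))⟩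
  refine ⟨f, hf, hfu, ⟨Q, hQ⟩, fun v ↦ ?_⟩
  refine Simplex.ext rfl (funext fun i ↦ funext fun j ↦ ?_)
  change X.φ (𝒢'.mul (𝒢'.inv (x i v)) (x j v)) = (P.1 (f v)).hom i j
  rw [X.φ_mul _ _ (hcomp i j v), X.φ_inv, hφx, hφx,
    ← (P.1 (f v)).hom_mul_hom 0 i j, 𝒢.inv_mul_cancel_left' (by
      rw [Simplex.src_hom, Simplex.tgt_hom])]

theorem IsCentral.pullbackForm_injective (hX : X.IsCentral) (p q : ℕ) :
    Function.Injective (X.pullbackForm V p q) := fun θ η h ↦ Form.ext fun k P u ↦ by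
  obtain ⟨f, hf, hfu, Q, hQ⟩ := hX.exists_isLift P u
  rw [← θ.comp_eventuallyEq_id P hf hfu, ← η.comp_eventuallyEq_id P hf hfu,
    ← hQ.pullbackForm_apply, ← hQ.pullbackForm_apply, h]

theorem IsCentral.pullback_injective (hX : X.IsCentral) :
    Function.Injective (X.pullback V) := fun _ _ h ↦
  funext fun p ↦ funext fun q ↦ hX.pullbackForm_injective p q (congrFun (congrFun h p) q)

variable (X)

/-- A form on the nerve of `Γ'` is basic if it takes the same values on any two lifts of a plot of
the nerve of `Γ`. -/
def IsBasic (θ : 𝒢'.Form p q V) : Prop :=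
  ∀ (k : ℕ) (P Q : 𝒢'.Plot q k), (∀ u, X.nerveMap q (P.1 u) = X.nerveMap q (Q.1 u)) →
    ∀ u, θ.1 k P u = θ.1 k Q u

variable {X}

omit [IsManifold (𝓡 n) ∞ Γ] [IsManifold (𝓡 n') ∞ Γ'] in
theorem IsBasic.of_isLift {θ : 𝒢'.Form p q V} (hθ : X.IsBasic θ) {k : ℕ} {P : 𝒢.Plot q k}
    {Q Q' : 𝒢'.Plot q k} (h : X.IsLift Q P) (h' : X.IsLift Q' P) : θ.1 k Q = θ.1 k Q' :=
  funext (hθ k Q Q' fun u ↦ (h u).trans (h' u).symm)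

/-- Basic forms descend. -/
theorem IsBasic.exists_pullbackForm_eq {θ : 𝒢'.Form p q V} (hθ : X.IsBasic θ) (hX : X.IsCentral) :
    ∃ η : 𝒢.Form p q V, X.pullbackForm V p q η = θ := by
  choose f hf hfu L hL using fun k P u ↦ hX.exists_isLift (q := q) (k := k) P u
  let η : 𝒢.FormFamily p q V := fun k P u ↦ θ.1 k (L k P u) u
  -- The value of `η` can be computed from any lift of any pullback of the plot.
  have key : ∀ (k l : ℕ) (P : 𝒢.Plot q k)
      (g : EuclideanSpace ℝ (Fin l) → EuclideanSpace ℝ (Fin k)) (hg : ContDiff ℝ ∞ g)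
      (Q : 𝒢'.Plot q l) (_ : X.IsLift Q (P.comp g hg)) (u : EuclideanSpace ℝ (Fin l)),
      θ.1 l Q u = (η k P (g u)).compContinuousLinearMap (fderiv ℝ g u) := by
    intro k l P g hg Q hQ u
    obtain ⟨c, hc, hcu, hcO⟩ := exists_contDiff_eventuallyEq_id (u := u)
      (hg.continuous.continuousAt.preimage_mem_nhds (hfu k P (g u)))
    have h1 : X.IsLift ((L k P (g u)).comp (g ∘ c) (hg.comp hc))
        ((P.comp g hg).comp c hc) := fun v ↦ by
      refine ((hL k P (g u)) (g (c v))).trans ?_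
      exact congrArg P.1 (hcO v)
    have h2 := congrFun (hθ.of_isLift (hQ.comp hc) h1) u
    have h3 : fderiv ℝ (g ∘ c) u = fderiv ℝ g u :=
      (hcu.fun_comp g).fderiv_eq
    rw [θ.comp_eventuallyEq_id Q hc hcu, θ.isForm.comp _ _ _ _ (hg.comp hc), h3] at h2
    rw [h2, Function.comp_apply, hcu.self_of_nhds]
    rfl
  have hη : FormFamily.IsForm η := by
    refine ⟨fun k P ↦ contDiff_iff_contDiffAt.2 fun u ↦ ?_, fun k l P g hg u ↦ ?_⟩
    · refine (θ.isForm.contDiff k (L k P u)).contDiffAt.congr_of_eventuallyEq ?_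
      filter_upwards [(hfu k P u).eventually_nhds] with v hv
      have hv' : f k P u =ᶠ[nhds v] id := hv
      have h1 : fderiv ℝ (f k P u) v = ContinuousLinearMap.id ℝ _ := hv'.fderiv_eq.trans fderiv_id
      rw [key k k P _ (hf k P u) (L k P u) (hL k P u) v, h1, hv'.self_of_nhds]
      rfl
    · have h1 := key k l P (g ∘ f l (P.comp g hg) u) (hg.comp (hf l (P.comp g hg) u))
        (L l (P.comp g hg) u) (hL l (P.comp g hg) u) u
      have h3 : fderiv ℝ (g ∘ f l (P.comp g hg) u) u = fderiv ℝ g u :=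
        ((hfu l (P.comp g hg) u).fun_comp g).fderiv_eq
      rw [h3, Function.comp_apply, (hfu l (P.comp g hg) u).self_of_nhds] at h1
      exact h1
  refine ⟨⟨η, hη⟩, Form.ext fun k P u ↦ ?_⟩
  have h := key k k ⟨X.nerveMap q ∘ P.1, X.isSmoothMap_nerveMap q k P⟩ id contDiff_id P
    (fun _ ↦ rfl) u
  rw [fderiv_id] at h
  exact h.symm

theorem IsCentral.exists_pullback_eq (hX : X.IsCentral) {c : 𝒢'.Cochain V}
    (hc : ∀ p q, X.IsBasic (c p q)) : ∃ b : 𝒢.Cochain V, X.pullback V b = c := by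
  choose b hb using fun p q ↦ (hc p q).exists_pullbackForm_eq hX
  exact ⟨b, funext fun p ↦ funext fun q ↦ hb p q⟩

theorem IsCentral.mem_Tot_of_pullback (hX : X.IsCentral) {c : 𝒢.Cochain V} {k : ℕ}
    (hc : X.pullback V c ∈ 𝒢'.Tot V k) : c ∈ 𝒢.Tot V k := fun p q h ↦
  hX.pullbackForm_injective p q ((hc p q h).trans (map_zero (X.pullbackForm V p q)).symm)

end GExtension

end LieGroupoid

/-! ### The projection of a connection form to the center -/

theorem IsReductiveLieGroup.pr_lie {r : ℕ} {G : Type*} [TopologicalSpace G]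
    [ChartedSpace (EuclideanSpace ℝ (Fin r)) G] [Group G] [LieGroup (𝓡 r) ∞ G]
    (hG : IsReductiveLieGroup r G) (ξ η : LieAlg r G) : hG.pr ⁅ξ, η⁆ = 0 := by
  refine (Submodule.projectionOnto_apply_eq_zero_iff _).2 ?_
  exact LieSubmodule.lie_mem_lie (LieSubmodule.mem_top ξ) (LieSubmodule.mem_top η)

namespace LieGroupoid

namespace GExtension

variable {m n n' r : ℕ} {M Γ Γ' G V : Type*}
  [TopologicalSpace M] [ChartedSpace (EuclideanSpace ℝ (Fin m)) M]
  [TopologicalSpace Γ] [ChartedSpace (EuclideanSpace ℝ (Fin n)) Γ]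
  [TopologicalSpace Γ'] [ChartedSpace (EuclideanSpace ℝ (Fin n')) Γ']
  [TopologicalSpace G] [ChartedSpace (EuclideanSpace ℝ (Fin r)) G] [Group G]
  [NormedAddCommGroup V] [NormedSpace ℝ V]
  {𝒢' : LieGroupoid m n' M Γ'} {𝒢 : LieGroupoid m n M Γ} {X : GExtension 𝒢' 𝒢 r G} {p q : ℕ}

/-- The edges of two plots over the same plot of the nerve of `Γ` differ by smooth maps to `G`. -/
theorem exists_hom_eq_act {k : ℕ} {P Q : 𝒢'.Plot q k}
    (h : ∀ u, X.nerveMap q (P.1 u) = X.nerveMap q (Q.1 u)) (i j : Fin (q + 1)) :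
    ∃ g : EuclideanSpace ℝ (Fin k) → G, ContMDiff (𝓡 k) (𝓡 r) ∞ g ∧
      ∀ u, (Q.1 u).hom i j = X.act (g u) ((P.1 u).hom i j) := by
  choose g hg using fun u ↦ X.exists_eq_act
    (x := (P.1 u).hom i j) (y := (Q.1 u).hom i j)
    (congrArg (fun σ : 𝒢.Simplex q ↦ σ.hom i j) (h u))
  exact ⟨g, fun u ↦ X.contMDiffAt_of_eq_act (P.2.2 i j u) (Q.2.2 i j u)
    (Filter.Eventually.of_forall hg), hg⟩

variable [IsManifold (𝓡 n') ∞ Γ']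

theorem mapCoeff_toForm_apply (ℓ : LieAlg r G →L[ℝ] V) (α : OneForm n' Γ' (LieAlg r G)) (k : ℕ)
    (P : 𝒢'.Plot 1 k) (u : EuclideanSpace ℝ (Fin k)) :
    (Form.mapCoeff ℓ (α.toForm 𝒢')).1 k P u =
      ContinuousAlternatingMap.ofSubsingleton ℝ (EuclideanSpace ℝ (Fin k)) V (0 : Fin 1)
        (ℓ.comp (α.pull (fun v ↦ (P.1 v).hom 0 1) u)) := by
  ext v; rfl

/-- The faces of a 2-simplex `(x, y)` are `y`, `xy` and `x`. -/
theorem del_mapCoeff_toForm_apply (ℓ : LieAlg r G →L[ℝ] V) (α : OneForm n' Γ' (LieAlg r G))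
    (k : ℕ) (P : 𝒢'.Plot 2 k) (u : EuclideanSpace ℝ (Fin k)) :
    (Form.del (Form.mapCoeff ℓ (α.toForm 𝒢'))).1 k P u =
      ContinuousAlternatingMap.ofSubsingleton ℝ (EuclideanSpace ℝ (Fin k)) V (0 : Fin 1)
        (ℓ.comp (α.pull (fun v ↦ (P.1 v).hom 0 2) u)
          - ℓ.comp (α.pull (fun v ↦ (P.1 v).hom 0 1) u)
          - ℓ.comp (α.pull (fun v ↦ (P.1 v).hom 1 2) u)) := by
  have h : Form.del (Form.mapCoeff ℓ (α.toForm 𝒢')) =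
      Form.pullback 1 V (Simplex.face 1) (𝒢'.isSmoothMap_face 1 1) (Form.mapCoeff ℓ (α.toForm 𝒢'))
      - Form.pullback 1 V (Simplex.face 2) (𝒢'.isSmoothMap_face 1 2)
          (Form.mapCoeff ℓ (α.toForm 𝒢'))
      - Form.pullback 1 V (Simplex.face 0) (𝒢'.isSmoothMap_face 1 0)
          (Form.mapCoeff ℓ (α.toForm 𝒢')) := by
    rw [Form.del_apply, Fin.sum_univ_three]
    simp only [Fin.val_zero, Fin.val_one, Fin.val_two, pow_zero, pow_one, one_smul, neg_smul,
      even_two.neg_pow, one_pow]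
    abel
  rw [h]
  ext v; rfl

variable [LieGroup (𝓡 r) ∞ G] [ConnectedSpace G] {ℓ : LieAlg r G →L[ℝ] V}
  {α : OneForm n' Γ' (LieAlg r G)}

theorem IsConnection.comp_pull_eq (hα : X.IsConnection α) (hℓ : ∀ ξ η : LieAlg r G, ℓ ⁅ξ, η⁆ = 0)
    {k : ℕ} {x y : EuclideanSpace ℝ (Fin k) → Γ'} {g : EuclideanSpace ℝ (Fin k) → G}
    (hx : ContMDiff (𝓡 k) (𝓡 n') ∞ x) (hg : ContMDiff (𝓡 k) (𝓡 r) ∞ g)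
    (h : ∀ v, y v = X.act (g v) (x v)) (u : EuclideanSpace ℝ (Fin k)) :
    ℓ.comp (α.pull y u) = ℓ.comp (α.pull x u) + ℓ.comp (maurerCartan g u) := by
  rw [funext h]
  exact X.comp_pull_act hℓ hα (hx.mdifferentiableAt (by simp)) (hg.mdifferentiableAt (by simp))

/-- The change `ℓ ∘ g^*θ` of a connection form under a change of lift is closed. -/
theorem IsConnection.isBasic_d (hα : X.IsConnection α)
    (hℓ : ∀ ξ η : LieAlg r G, ℓ ⁅ξ, η⁆ = 0) :
    X.IsBasic (Form.d (Form.mapCoeff ℓ (α.toForm 𝒢'))) := fun k P Q h u ↦ by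
  obtain ⟨g, hg, hgPQ⟩ := exists_hom_eq_act h 0 1
  have h1 : (Form.mapCoeff ℓ (α.toForm 𝒢')).1 k Q = (Form.mapCoeff ℓ (α.toForm 𝒢')).1 k P +
      fun v ↦ ContinuousAlternatingMap.ofSubsingleton ℝ (EuclideanSpace ℝ (Fin k)) V (0 : Fin 1)
        (ℓ.comp (maurerCartan g v)) := funext fun v ↦ by
    rw [Pi.add_apply, mapCoeff_toForm_apply, mapCoeff_toForm_apply,
      hα.comp_pull_eq hℓ (P.2.2 0 1) hg hgPQ]
    rfl
  change extDeriv _ u = extDeriv _ u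
  rw [h1, extDeriv_add
    (((Form.mapCoeff ℓ (α.toForm 𝒢')).isForm.contDiff k P).differentiable (by simp) u)
    (differentiableAt_ofSubsingleton
      (((contDiffAt_maurerCartan (hg u)).differentiableAt (by simp)).const_clm_comp' ℓ)),
    extDeriv_maurerCartan hℓ (hg u), add_zero]

/-- Replacing `(x, y)` by `(x g, y h)` replaces `xy` by `xy · (k⁻¹ g k) h`, where `y` is the
translate by `k` of an arrow which commutes with `G`. -/
theorem IsConnection.isBasic_del (hα : X.IsConnection α) (hX : X.IsCentral)
    (hℓ : ∀ ξ η : LieAlg r G, ℓ ⁅ξ, η⁆ = 0) [IsManifold (𝓡 n) ∞ Γ] :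
    X.IsBasic (Form.del (Form.mapCoeff ℓ (α.toForm 𝒢'))) := fun κ P Q hPQ u ↦ by
  obtain ⟨g, hg, hgPQ⟩ := exists_hom_eq_act hPQ 0 1
  obtain ⟨h, hh, hhPQ⟩ := exists_hom_eq_act hPQ 1 2
  obtain ⟨l, hl, hlPQ⟩ := exists_hom_eq_act hPQ 0 2
  obtain ⟨U, hU, hmem, τ, hτ, hτU⟩ := hX.exists_section (X.φ ((P.1 u).hom 1 2))
  have hφ : ContMDiff (𝓡 κ) (𝓡 n) ∞ fun v ↦ X.φ ((P.1 v).hom 1 2) :=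
    X.φ_contMDiff.comp (P.2.2 1 2)
  have hev : ∀ᶠ v in nhds u, X.φ ((P.1 v).hom 1 2) ∈ U :=
    hφ.continuous.continuousAt.preimage_mem_nhds (hU.mem_nhds hmem)
  -- Only the germ of `k` at `u` matters. Off the domain `U` of the local section it is arbitrary.
  have hk : ∀ v, ∃ k, X.φ ((P.1 v).hom 1 2) ∈ U →
      (P.1 v).hom 1 2 = X.act k (τ (X.φ ((P.1 v).hom 1 2))) := fun v ↦ by
    by_cases hv : X.φ ((P.1 v).hom 1 2) ∈ U
    · obtain ⟨k, hk⟩ := X.exists_eq_act (hτU _ hv).1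
      exact ⟨k, fun _ ↦ hk⟩
    · exact ⟨1, fun h ↦ absurd h hv⟩
  choose k hk using hk
  have hks : ContMDiffAt (𝓡 κ) (𝓡 r) ∞ k u :=
    X.contMDiffAt_of_eq_act (((hτ _ hmem).contMDiffAt (hU.mem_nhds hmem)).comp u (hφ u))
      (P.2.2 1 2 u) (hev.mono hk)
  have hl' : l =ᶠ[nhds u] fun v ↦ (k v)⁻¹ * (g v * k v) * h v := hev.mono fun v hv ↦ by
    refine X.act_left_injective ((P.1 v).hom 0 2) ?_
    dsimp only
    rw [← hlPQ v, ← (Q.1 v).hom_mul_hom 0 1 2, ← (P.1 v).hom_mul_hom 0 1 2, hgPQ v, hhPQ v,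
      X.act_mul_act (by rw [Simplex.src_hom, Simplex.tgt_hom]) (hk v hv) (hτU _ hv).2]
  rw [del_mapCoeff_toForm_apply, del_mapCoeff_toForm_apply,
    hα.comp_pull_eq hℓ (P.2.2 0 1) hg hgPQ, hα.comp_pull_eq hℓ (P.2.2 1 2) hh hhPQ,
    hα.comp_pull_eq hℓ (P.2.2 0 2) hl hlPQ, maurerCartan_congr hl',
    comp_maurerCartan_conj_mul hℓ (hg.mdifferentiableAt (by simp))
      (hh.mdifferentiableAt (by simp)) hks]
  congr 1
  abel

/-- The change `ℓ ∘ g^*θ` under a change of lift is the same for all connection forms. -/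
theorem IsConnection.isBasic_sub {α₁ α₂ : OneForm n' Γ' (LieAlg r G)} (h₁ : X.IsConnection α₁)
    (h₂ : X.IsConnection α₂) (hℓ : ∀ ξ η : LieAlg r G, ℓ ⁅ξ, η⁆ = 0) :
    X.IsBasic (Form.mapCoeff ℓ (α₁.toForm 𝒢') - Form.mapCoeff ℓ (α₂.toForm 𝒢')) :=
  fun k P Q h u ↦ by
    obtain ⟨g, hg, hgPQ⟩ := exists_hom_eq_act h 0 1
    change (Form.mapCoeff ℓ (α₁.toForm 𝒢')).1 k P u - (Form.mapCoeff ℓ (α₂.toForm 𝒢')).1 k P u =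
      (Form.mapCoeff ℓ (α₁.toForm 𝒢')).1 k Q u - (Form.mapCoeff ℓ (α₂.toForm 𝒢')).1 k Q u
    simp only [mapCoeff_toForm_apply]
    rw [h₁.comp_pull_eq hℓ (P.2.2 0 1) hg hgPQ, h₂.comp_pull_eq hℓ (P.2.2 0 1) hg hgPQ]
    ext v
    exact (add_sub_add_right_eq_sub _ _ _).symm

end GExtension
end LieGroupoid

/-! ### Cohomology with coefficients -/

namespace LieGroupoid

section Tensor

variable {m n : ℕ} {M Γ V W : Type*}
  [TopologicalSpace M] [ChartedSpace (EuclideanSpace ℝ (Fin m)) M]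
  [TopologicalSpace Γ] [ChartedSpace (EuclideanSpace ℝ (Fin n)) Γ]
  [NormedAddCommGroup V] [NormedSpace ℝ V] [NormedAddCommGroup W] [NormedSpace ℝ W]
  {𝒢 : LieGroupoid m n M Γ} {k : ℕ}

theorem Cohomology.mk_eq_mk_iff {c c' : 𝒢.Cocycles V k} :
    Cohomology.mk c = Cohomology.mk c' ↔ (c : 𝒢.Cochain V) - c' ∈ 𝒢.Coboundaries V k :=
  Submodule.Quotient.eq _

/-- The canonical map `H^k(Γ) ⊗ V → H^k(Γ, V)` is an isomorphism for finite-dimensional `V`: if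
`eᵢ` is a basis of `V`, with dual basis `eᵢ^*`, then its inverse is `x ↦ ∑ᵢ eᵢ^*(x) ⊗ eᵢ`. -/
theorem Cohomology.ofTensor_bijective [FiniteDimensional ℝ V] :
    Function.Bijective (Cohomology.ofTensor 𝒢 V k) := by
  let b := Module.finBasis ℝ V
  let b' : Fin (Module.finrank ℝ V) → V →L[ℝ] ℝ := fun i ↦
    LinearMap.toContinuousLinearMap (b.coord i)
  have hb : ∀ v, ∑ i, b' i v • b i = v := b.sum_repr
  refine Function.bijective_iff_has_inverse.2
    ⟨fun x ↦ ∑ i, Cohomology.mapCoeff 𝒢 k (b' i) x ⊗ₜ b i, fun t ↦ ?_, fun x ↦ ?_⟩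
  · induction t with
    | zero => simp
    | add s t hs ht =>
      simp only [map_add, TensorProduct.add_tmul, Finset.sum_add_distrib] at hs ht ⊢
      rw [hs, ht]
    | tmul x v =>
      have h : ∀ i, Cohomology.mapCoeff 𝒢 k (b' i) (Cohomology.ofTensor 𝒢 V k (x ⊗ₜ v)) =
          b' i v • x := fun i ↦ by
        obtain ⟨c, rfl⟩ := Submodule.Quotient.mk_surjective _ x
        refine congrArg Submodule.Quotient.mk (Subtype.ext ?_)
        funext p q; refine Form.ext fun l P u ↦ ?_; ext e
        change b' i ((c.1 p q).1 l P u e • v) = b' i v • (c.1 p q).1 l P u e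
        rw [map_smul, smul_eq_mul, smul_eq_mul, mul_comm]
      simp only [h, TensorProduct.smul_tmul, ← TensorProduct.tmul_sum, hb]
  · dsimp only
    rw [map_sum]
    obtain ⟨c, rfl⟩ := Submodule.Quotient.mk_surjective _ x
    refine Eq.trans (map_sum ((Coboundaries 𝒢 V k).submoduleOf (Cocycles 𝒢 V k)).mkQ
      (fun i ↦ (⟨Cochain.mapCoeff ((ContinuousLinearMap.toSpanSingleton ℝ (b i)).comp (b' i)) c,
        mapCoeff_mem_Cocycles _ c.2⟩ : Cocycles 𝒢 V k)) Finset.univ).symm ?_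
    refine congrArg Submodule.Quotient.mk (Subtype.ext ?_)
    rw [AddSubmonoidClass.coe_finsetSum]
    funext p q
    rw [Finset.sum_apply, Finset.sum_apply]
    refine Form.ext fun l P u ↦ ?_
    have h : ∀ s : Finset (Fin (Module.finrank ℝ V)), ∀ f : Fin (Module.finrank ℝ V) → 𝒢.Form p q V,
        ∀ e, (∑ i ∈ s, f i).1 l P u e = ∑ i ∈ s, (f i).1 l P u e := fun s f e ↦
      map_sum ({ toFun := fun θ ↦ θ.1 l P u e, map_zero' := rfl, map_add' := fun _ _ ↦ rfl } :
        𝒢.Form p q V →+ V) f s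
    ext e
    exact (h _ _ e).trans (hb _)

end Tensor

end LieGroupoid

/-! ### The curvature cochain -/

namespace LieGroupoid

namespace GExtension

variable {m n n' r : ℕ} {M Γ Γ' G V : Type*}
  [TopologicalSpace M] [ChartedSpace (EuclideanSpace ℝ (Fin m)) M]
  [TopologicalSpace Γ] [ChartedSpace (EuclideanSpace ℝ (Fin n)) Γ] [IsManifold (𝓡 n) ∞ Γ]
  [TopologicalSpace Γ'] [ChartedSpace (EuclideanSpace ℝ (Fin n')) Γ'] [IsManifold (𝓡 n') ∞ Γ']
  [TopologicalSpace G] [ChartedSpace (EuclideanSpace ℝ (Fin r)) G] [Group G]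
  [NormedAddCommGroup V] [NormedSpace ℝ V]
  {𝒢' : LieGroupoid m n' M Γ'} {𝒢 : LieGroupoid m n M Γ} {X : GExtension 𝒢' 𝒢 r G} {p q : ℕ}

theorem pullback_single (η : 𝒢.Form p q V) :
    X.pullback V (Pi.single p (Pi.single q η)) =
      Pi.single p (Pi.single q (X.pullbackForm V p q η)) := by
  funext p' q'
  change X.pullbackForm V p' q' _ = _
  by_cases hp : p' = p
  · subst hp
    by_cases hq : q' = q
    · subst hq; simp
    · simp [hq]
  · simp [hp]

omit [IsManifold (𝓡 n) ∞ Γ] [IsManifold (𝓡 n') ∞ Γ'] in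
theorem isBasic_zero : X.IsBasic (0 : 𝒢'.Form p q V) := fun _ _ _ _ _ ↦ rfl

/-- If `dθ` and `∂θ` are basic, then the total differential of `θ` descends. -/
theorem IsCentral.exists_pullback_eq_totalD (hX : X.IsCentral) {θ : 𝒢'.Form p q V}
    (hd : X.IsBasic (Form.d θ)) (hdel : X.IsBasic (Form.del θ)) :
    ∃ Ω, X.pullback V Ω = 𝒢'.totalD V (Pi.single p (Pi.single q θ)) := by
  refine hX.exists_pullback_eq fun p' q' ↦ ?_
  have hd' : X.IsBasic (dComponent p' q' (Pi.single p (Pi.single q θ) : 𝒢'.Cochain V)) := by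
    rcases p' with _ | p'
    · exact isBasic_zero
    change X.IsBasic (Form.d ((Pi.single p (Pi.single q θ) : 𝒢'.Cochain V) p' q'))
    by_cases hp : p' = p
    · subst hp
      by_cases hq : q' = q
      · subst hq; simpa using hd
      · simpa [hq] using isBasic_zero
    · simpa [hp] using isBasic_zero
  have hdel' : X.IsBasic (delComponent p' q' (Pi.single p (Pi.single q θ) : 𝒢'.Cochain V)) := by
    rcases q' with _ | q'
    · exact isBasic_zero
    change X.IsBasic (Form.del ((Pi.single p (Pi.single q θ) : 𝒢'.Cochain V) p' q'))
    by_cases hp : p' = p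
    · subst hp
      by_cases hq : q' = q
      · subst hq; simpa using hdel
      · simpa [hq] using isBasic_zero
    · simpa [hp] using isBasic_zero
  exact fun k P Q h u ↦ congrArg₂ (· + ·) (hd' k P Q h u) (hdel' k P Q h u)

theorem IsCentral.mem_Cocycles_of_pullback_eq_totalD (hX : X.IsCentral) {k : ℕ}
    {c : 𝒢'.Cochain V} (hc : c ∈ 𝒢'.Tot V k) {Ω : 𝒢.Cochain V}
    (h : X.pullback V Ω = 𝒢'.totalD V c) : Ω ∈ 𝒢.Cocycles V (k + 1) := by
  refine ⟨hX.mem_Tot_of_pullback (h ▸ totalD_mem_Tot hc), hX.pullback_injective ?_⟩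
  rw [← totalD_pullback, h, totalD_totalD, map_zero]

/-- If `θ₁ - θ₂` is basic, then the cochains to which the total differentials of `θ₁` and `θ₂`
descend differ by the total differential of the form to which `θ₁ - θ₂` descends. -/
theorem IsCentral.sub_mem_Coboundaries (hX : X.IsCentral) {θ₁ θ₂ : 𝒢'.Form p q V}
    (hθ : X.IsBasic (θ₁ - θ₂)) {Ω₁ Ω₂ : 𝒢.Cochain V}
    (h₁ : X.pullback V Ω₁ = 𝒢'.totalD V (Pi.single p (Pi.single q θ₁)))
    (h₂ : X.pullback V Ω₂ = 𝒢'.totalD V (Pi.single p (Pi.single q θ₂))) :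
    Ω₁ - Ω₂ ∈ 𝒢.Coboundaries V (p + q + 1) := by
  obtain ⟨b, hb⟩ := hθ.exists_pullbackForm_eq hX
  refine ⟨Pi.single p (Pi.single q b), single_mem_Tot b, hX.pullback_injective ?_⟩
  rw [← totalD_pullback, pullback_single, hb, Pi.single_sub, Pi.single_sub, map_sub, map_sub, h₁,
    h₂]

theorem mapCoeff_totalD_toCochain (ℓ : LieAlg r G →L[ℝ] V) (α : OneForm n' Γ' (LieAlg r G)) :
    Cochain.mapCoeff ℓ (𝒢'.totalD (LieAlg r G) (α.toCochain 𝒢')) =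
      𝒢'.totalD V (Pi.single 1 (Pi.single 1 (Form.mapCoeff ℓ (α.toForm 𝒢')))) := by
  rw [← totalD_mapCoeff, OneForm.toCochain, mapCoeff_single]

variable [LieGroup (𝓡 r) ∞ G] {hG : IsReductiveLieGroup r G}

theorem isCurvatureOf_iff {α : OneForm n' Γ' (LieAlg r G)} {Ω : 𝒢.Cochain (lieCenter r G)} :
    X.IsCurvatureOf hG α Ω ↔ X.pullback (lieCenter r G) Ω =
      𝒢'.totalD _ (Pi.single 1 (Pi.single 1 (Form.mapCoeff hG.pr (α.toForm 𝒢')))) := by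
  rw [IsCurvatureOf, mapCoeff_totalD_toCochain, eq_comm]

theorem IsCurvatureOf.mem_Cocycles {α : OneForm n' Γ' (LieAlg r G)}
    {Ω : 𝒢.Cochain (lieCenter r G)} (h : X.IsCurvatureOf hG α Ω) (hX : X.IsCentral) :
    Ω ∈ 𝒢.Cocycles (lieCenter r G) 3 :=
  hX.mem_Cocycles_of_pullback_eq_totalD (single_mem_Tot (p := 1) (q := 1) _) (isCurvatureOf_iff.1 h)

variable [ConnectedSpace G]

theorem IsConnection.exists_isCurvatureOf {α : OneForm n' Γ' (LieAlg r G)} (hα : X.IsConnection α)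
    (hX : X.IsCentral) (hG : IsReductiveLieGroup r G) : ∃ Ω, X.IsCurvatureOf hG α Ω := by
  obtain ⟨Ω, hΩ⟩ :=
    hX.exists_pullback_eq_totalD (hα.isBasic_d hG.pr_lie) (hα.isBasic_del hX hG.pr_lie)
  exact ⟨Ω, isCurvatureOf_iff.2 hΩ⟩

theorem IsCurvatureOf.sub_mem_Coboundaries {α₁ α₂ : OneForm n' Γ' (LieAlg r G)}
    {Ω₁ Ω₂ : 𝒢.Cochain (lieCenter r G)} (h₁ : X.IsCurvatureOf hG α₁ Ω₁)
    (h₂ : X.IsCurvatureOf hG α₂ Ω₂) (hα₁ : X.IsConnection α₁) (hα₂ : X.IsConnection α₂)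
    (hX : X.IsCentral) : Ω₁ - Ω₂ ∈ 𝒢.Coboundaries (lieCenter r G) 3 :=
  hX.sub_mem_Coboundaries (hα₁.isBasic_sub hα₂ hG.pr_lie) (isCurvatureOf_iff.1 h₁)
    (isCurvatureOf_iff.1 h₂)

end GExtension

end LieGroupoid

theorem proposition4p6 {m n n' r : ℕ} {M Γ Γ' G : Type*}
    [TopologicalSpace M] [ChartedSpace (EuclideanSpace ℝ (Fin m)) M] [IsManifold (𝓡 m) ∞ M]
    [TopologicalSpace Γ] [ChartedSpace (EuclideanSpace ℝ (Fin n)) Γ] [IsManifold (𝓡 n) ∞ Γ]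
    [TopologicalSpace Γ'] [ChartedSpace (EuclideanSpace ℝ (Fin n')) Γ'] [IsManifold (𝓡 n') ∞ Γ']
    [TopologicalSpace G] [ChartedSpace (EuclideanSpace ℝ (Fin r)) G] [Group G]
    [LieGroup (𝓡 r) ∞ G] [ConnectedSpace G] (hG : IsReductiveLieGroup r G)
    (𝒢' : LieGroupoid m n' M Γ') (𝒢 : LieGroupoid m n M Γ)
    (X : LieGroupoid.GExtension 𝒢' 𝒢 r G) (hX : X.IsCentral) :
    (∀ α, X.IsConnection α → ∃! Ω, Ω ∈ 𝒢.Cocycles (lieCenter r G) 3 ∧ X.IsCurvatureOf hG α Ω) ∧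
    (∀ α₁ α₂ Ω₁ Ω₂, X.IsConnection α₁ → X.IsConnection α₂ →
      Ω₁ ∈ 𝒢.Cocycles (lieCenter r G) 3 → Ω₂ ∈ 𝒢.Cocycles (lieCenter r G) 3 →
      X.IsCurvatureOf hG α₁ Ω₁ → X.IsCurvatureOf hG α₂ Ω₂ →
      Ω₁ - Ω₂ ∈ 𝒢.Coboundaries (lieCenter r G) 3) ∧
    ((∃ α, X.IsConnection α) →
      ∃! c : 𝒢.Cohomology ℝ 3 ⊗[ℝ] lieCenter r G,
        ∀ α, X.IsConnection α → ∀ Ω : 𝒢.Cocycles (lieCenter r G) 3, X.IsCurvatureOf hG α Ω →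
          LieGroupoid.Cohomology.ofTensor 𝒢 (lieCenter r G) 3 c =
            LieGroupoid.Cohomology.mk Ω) := by
  refine ⟨fun α hα ↦ ?_, fun α₁ α₂ Ω₁ Ω₂ hα₁ hα₂ _ _ h₁ h₂ ↦
    h₁.sub_mem_Coboundaries h₂ hα₁ hα₂ hX, fun ⟨α, hα⟩ ↦ ?_⟩
  · obtain ⟨Ω, hΩ⟩ := hα.exists_isCurvatureOf hX hG
    exact ⟨Ω, ⟨hΩ.mem_Cocycles hX, hΩ⟩,
      fun Ω' h ↦ hX.pullback_injective (h.2.symm.trans hΩ)⟩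
  · obtain ⟨Ω, hΩ⟩ := hα.exists_isCurvatureOf hX hG
    have hbij := LieGroupoid.Cohomology.ofTensor_bijective (𝒢 := 𝒢) (V := lieCenter r G) (k := 3)
    obtain ⟨c, hc⟩ := hbij.surjective
      (LieGroupoid.Cohomology.mk ⟨Ω, hΩ.mem_Cocycles hX⟩)
    refine ⟨c, fun α' hα' Ω' h' ↦ hc.trans ?_, fun c' hc' ↦
      hbij.injective ((hc' α hα ⟨Ω, hΩ.mem_Cocycles hX⟩ hΩ).trans hc.symm)⟩
    exact LieGroupoid.Cohomology.mk_eq_mk_iff.2 (hΩ.sub_mem_Coboundaries h' hα hα' hX)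

end
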